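/- Let $E$ be an elliptic curve over $\mathbb{Q}$ and let $p$ be a prime at which $E$ has good ordinary reduction; that is, the reduction of a minimal Weierstrass model of $E$ at $p$ is a nonsingular curve over $\mathbb{F}_p$ that has a point of order $p$ over $\overline{\mathbb{F}}_p$. For $n\ge 1$ let $\#E(\mathbb{F}_{p^n})$ be the number of points over $\mathbb{F}_{p^n}$ (including the point at infinity) of this reduction, and put $$a_n = p^n+1-\#E(\mathbb{F}_{p^n}),\qquad \alpha_n=\frac{a_n}{2p^{n/2}} .$$ Then the following hold. 1. There is $\theta\in[0,\pi]$ such that the two roots in $\mathbb{C}$, counted with multiplicity, of the characteristic polynomial of Frobenius $T^2-a_1T+p$ are $\tau=p^{1/2}e^{i\theta}$ and $\overline{\tau}$, and for every $n\ge 1$ $$a_n=\tau^n+\overline{\tau}^{\,n},\qquad \alpha_n=\frac{\tau^n+\overline{\tau}^{\,n}}{2p^{n/2}}=\cos(n\theta).$$ 2. The sequence $(\alpha_n)_{n\ge1}$ of normalized traces of Frobenius lies in $[-1,1]$ and is dense in $[-1,1]$. 3. The sequence $(\alpha_n)_{n\ge1}$ is not equidistributed on $[-1,1]$; that is, it is not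 true that for all $-1\le c\le d\le 1$ $$\lim_{N\to\infty}\frac{\#\{1\le n\le N:\alpha_n\in[c,d]\}}{N}=\frac{d-c}{2}.$$ -/

import Mathlib

noncomputable section

namespace FrobeniusTraces

/-- A minimal Weierstrass model at `p` of the curve `E` over the rational numbers, that is, a minimal
Weierstrass equation over the `p`-adic integers of `E` regarded over the `p`-adic numbers. -/
def minimalModel (E : WeierstrassCurve ℚ) (p : ℕ) [Fact p.Prime] : WeierstrassCurve ℚ_[p] :=
  (E.baseChange ℚ_[p]).minimal ℤ_[p]

instance (E : WeierstrassCurve ℚ) (p : ℕ) [Fact p.Prime] :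
    (minimalModel E p).IsMinimal ℤ_[p] :=
  inferInstanceAs (((E.baseChange ℚ_[p]).minimal ℤ_[p]).IsMinimal ℤ_[p])

/-- The reduction of `E` modulo `p`: the reduction of a minimal model at `p`, as a curve over the
field `ZMod p` with `p` elements. -/
def reductionMod (E : WeierstrassCurve ℚ) (p : ℕ) [Fact p.Prime] : WeierstrassCurve (ZMod p) :=
  ((minimalModel E p).reduction ℤ_[p]).map (PadicInt.residueField (p := p)).toRingHom

/-- A curve `W` over `ZMod p` is ordinary if it has a point of exact order `p` over an algebraic
closure of `ZMod p`. -/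
def IsOrdinary {p : ℕ} [Fact p.Prime] (W : WeierstrassCurve (ZMod p)) : Prop :=
  open Classical in
  ∃ P : (W.baseChange (AlgebraicClosure (ZMod p))).toAffine.Point, P ≠ 0 ∧ p • P = 0

/-- `E` has good ordinary reduction at `p`. -/
def HasGoodOrdinaryReduction (E : WeierstrassCurve ℚ) (p : ℕ) [Fact p.Prime] : Prop :=
  (minimalModel E p).HasGoodReduction ℤ_[p] ∧ IsOrdinary (reductionMod E p)

/-- The number of points of (the reduction modulo `p` of) `E` over the field with `p ^ n` elements,
the point at infinity included (for `n ≥ 1`). -/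
def pointCount (E : WeierstrassCurve ℚ) (p : ℕ) [Fact p.Prime] (n : ℕ) : ℕ :=
  Nat.card ((reductionMod E p).baseChange (GaloisField p n)).toAffine.Point

/-- The trace of Frobenius over the field with `p ^ n` elements. -/
def frobeniusTrace (E : WeierstrassCurve ℚ) (p : ℕ) [Fact p.Prime] (n : ℕ) : ℤ :=
  (p : ℤ) ^ n + 1 - (pointCount E p n : ℤ)

/-- The normalized trace of Frobenius. -/
def normalizedTrace (E : WeierstrassCurve ℚ) (p : ℕ) [Fact p.Prime] (n : ℕ) : ℝ :=
  (frobeniusTrace E p n : ℝ) / (2 * (p : ℝ) ^ ((n : ℝ) / 2))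

/-- The characteristic polynomial of the Frobenius of `E` at `p`, whose complex roots are
the Frobenius eigenvalues. -/
def frobeniusPolynomial (E : WeierstrassCurve ℚ) (p : ℕ) [Fact p.Prime] : Polynomial ℂ :=
  Polynomial.X ^ 2 - Polynomial.C (frobeniusTrace E p 1 : ℂ) * Polynomial.X + Polynomial.C (p : ℂ)

/-- The terms `u 1, u 2, …` of the sequence `u` lie in `[a, b]` and are dense there. -/
def IsDenseInInterval (u : ℕ → ℝ) (a b : ℝ) : Prop :=
  (∀ n, 1 ≤ n → u n ∈ Set.Icc a b) ∧ Set.Icc a b ⊆ closure (u '' {n | 1 ≤ n})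

/-- The sequence `u 1, u 2, …` is equidistributed on `[a, b]`: each subinterval `[c, d]` receives the
proportion `(d - c) / (b - a)` of the terms. -/
def IsEquidistributed (u : ℕ → ℝ) (a b : ℝ) : Prop :=
  open Classical in
  ∀ c d : ℝ, a ≤ c → c ≤ d → d ≤ b →
    Filter.Tendsto (fun N : ℕ => (((Finset.Icc 1 N).filter (fun n => u n ∈ Set.Icc c d)).card : ℝ) / N)
      Filter.atTop (nhds ((d - c) / (b - a)))

end FrobeniusTraces

end

/-!
Let `q` be the cardinality of the finite field and `φ` the `q`-power Frobenius endomorphism. The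
points of the curve over its own function field that the negation of the curve negates are, up to
translation by points of order two, its endomorphisms. The degree of their `x`-coordinate satisfies
the parallelogram law, because the addition-subtraction formula expresses the symmetric functions of
the `x`-coordinates of `P + Q` and `P - Q` by coprime forms in the `x`-coordinates of `P` and `Q`.
It is a positive semidefinite quadratic form that `φ` multiplies by `q`, and it is equal to
`#E(𝔽_{qⁿ})` at `φⁿ - 1`. Hence the traces satisfy `aₙ₊₂ = a₁ aₙ₊₁ - q aₙ`, and `a₁² ≤ 4 q` by the
Cauchy-Schwarz inequality, so that `aₙ = 2 q^{n/2} cos (n θ)`.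

A point of order `p` is defined over some `𝔽_{qⁿ}`, so `p` divides `#E(𝔽_{qⁿ})` and not `aₙ`. If
`θ` were a rational multiple of `2 π`, then some `a₂ₘ` would be equal to `2 qᵐ`, whereas
`aₙ ≡ a₁ⁿ` modulo `q`. So the multiples of `θ` are dense in the circle. The mean square of
`cos (n θ)` is `1 / 2`, but it would be `1 / 3` for an equidistributed sequence.
-/

namespace FrobeniusTraces

open Polynomial WeierstrassCurve
open WeierstrassCurve.Affine (Point)
open scoped Polynomial.Bivariate

/-! ### Vectors of polynomials without common zero -/

section PolynomialVectors

section CommRing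

variable {R ι : Type*} [CommRing R]

/-- `f` has degree at most `D`, and `a` is its coefficient in degree `D`, that is, the value at
infinity of `f` regarded as a form of degree `D`. -/
def HasTopCoeff (f : R[X]) (D : ℕ) (a : R) : Prop :=
  f.natDegree ≤ D ∧ f.coeff D = a

namespace HasTopCoeff

variable {f g : R[X]} {D E : ℕ} {a b : R}

lemma add (hf : HasTopCoeff f D a) (hg : HasTopCoeff g D b) : HasTopCoeff (f + g) D (a + b) :=
  ⟨natDegree_add_le_of_degree_le hf.1 hg.1, by rw [coeff_add, hf.2, hg.2]⟩

lemma sub (hf : HasTopCoeff f D a) (hg : HasTopCoeff g D b) : HasTopCoeff (f - g) D (a - b) :=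
  ⟨(natDegree_sub_le_of_le hf.1 hg.1).trans (max_self D).le, by rw [coeff_sub, hf.2, hg.2]⟩

lemma mul (hf : HasTopCoeff f D a) (hg : HasTopCoeff g E b) :
    HasTopCoeff (f * g) (D + E) (a * b) :=
  ⟨natDegree_mul_le_of_le hf.1 hg.1, by
    rw [coeff_mul_add_eq_of_natDegree_le hf.1 hg.1, hf.2, hg.2]⟩

lemma C_mul (c : R) (hf : HasTopCoeff f D a) : HasTopCoeff (C c * f) D (c * a) :=
  ⟨(natDegree_C_mul_le _ _).trans hf.1, by rw [coeff_C_mul, hf.2]⟩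

lemma pow (hf : HasTopCoeff f D a) (n : ℕ) : HasTopCoeff (f ^ n) (n * D) (a ^ n) :=
  ⟨natDegree_pow_le_of_le n hf.1, by rw [coeff_pow_of_natDegree_le hf.1, hf.2]⟩

lemma sum {κ : Type*} (s : Finset κ) {f : κ → R[X]} {a : κ → R}
    (h : ∀ i ∈ s, HasTopCoeff (f i) D (a i)) : HasTopCoeff (∑ i ∈ s, f i) D (∑ i ∈ s, a i) :=
  ⟨natDegree_sum_le_of_forall_le s f fun i hi ↦ (h i hi).1, by
    rw [finsetSum_coeff]; exact Finset.sum_congr rfl fun i hi ↦ (h i hi).2⟩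

end HasTopCoeff

/-- A vector of polynomials without common zero in the coefficient ring. Over an algebraically
closed field, it represents a morphism from the affine line to projective space. -/
def HasNoCommonZero (v : ι → R[X]) : Prop :=
  ∀ a : R, ∃ i, (v i).eval a ≠ 0

lemma HasNoCommonZero.ne_zero {v : ι → R[X]} (hv : HasNoCommonZero v) : v ≠ 0 := by
  rintro rfl
  obtain ⟨_, hi⟩ := hv 0
  exact hi eval_zero

variable [Fintype ι]

/-- The maximal degree of the entries of a vector of polynomials. -/
def maxDegree (v : ι → R[X]) : ℕ :=
  Finset.univ.sup fun i ↦ (v i).natDegree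

lemma natDegree_le_maxDegree (v : ι → R[X]) (i : ι) : (v i).natDegree ≤ maxDegree v :=
  Finset.le_sup (f := fun i ↦ (v i).natDegree) (Finset.mem_univ i)

lemma hasTopCoeff_maxDegree (v : ι → R[X]) (i : ι) :
    HasTopCoeff (v i) (maxDegree v) ((v i).coeff (maxDegree v)) :=
  ⟨natDegree_le_maxDegree v i, rfl⟩

lemma maxDegree_eq_of_hasTopCoeff {v : ι → R[X]} {D : ℕ} {a : ι → R}
    (h : ∀ i, HasTopCoeff (v i) D (a i)) (ha : a ≠ 0) : maxDegree v = D := by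
  obtain ⟨i, hi⟩ := Function.ne_iff.mp ha
  refine le_antisymm (Finset.sup_le fun i _ ↦ (h i).1)
    ((le_natDegree_of_ne_zero ?_).trans (natDegree_le_maxDegree v i))
  rwa [(h i).2]

lemma coeff_maxDegree_ne_zero {v : ι → R[X]} (hv : v ≠ 0) :
    (fun i ↦ (v i).coeff (maxDegree v)) ≠ 0 := by
  obtain ⟨i₀, hi₀⟩ := Function.ne_iff.mp hv
  obtain ⟨i, -, hi⟩ := Finset.exists_mem_eq_sup Finset.univ ⟨i₀, Finset.mem_univ _⟩
    (fun i ↦ (v i).natDegree)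
  by_cases h0 : v i = 0
  · have hD : (v i₀).natDegree = maxDegree v := by
      have := natDegree_le_maxDegree v i₀
      rw [maxDegree, hi, h0, natDegree_zero] at this ⊢
      exact Nat.le_zero.mp this
    exact Function.ne_iff.mpr ⟨i₀, by rw [← hD]; exact leadingCoeff_ne_zero.mpr hi₀⟩
  · exact Function.ne_iff.mpr ⟨i, by rw [maxDegree, hi]; exact leadingCoeff_ne_zero.mpr h0⟩

lemma maxDegree_C_mul [NoZeroDivisors R] (v : ι → R[X]) {c : R} (hc : c ≠ 0) :
    maxDegree (fun j ↦ C c * v j) = maxDegree v := by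
  simp only [maxDegree, natDegree_C_mul hc]

end CommRing

section AlgClosed

variable {k ι : Type*} [Field k] [IsAlgClosed k]

lemma isUnit_of_forall_eval_ne_zero {f : k[X]} (hf : ∀ a, f.eval a ≠ 0) : IsUnit f := by
  rw [isUnit_iff_degree_eq_zero]
  by_contra hd
  obtain ⟨a, ha⟩ := IsAlgClosed.exists_root f hd
  exact hf a ha

lemma HasNoCommonZero.span_eq_top {v : ι → k[X]} (hv : HasNoCommonZero v) :
    Ideal.span (Set.range v) = ⊤ := by
  obtain ⟨g, hg⟩ := IsPrincipalIdealRing.principal (Ideal.span (Set.range v))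
  rw [Ideal.submodule_span_eq] at hg
  rw [hg, Ideal.span_singleton_eq_top]
  refine isUnit_of_forall_eval_ne_zero fun a ha ↦ ?_
  obtain ⟨i, hi⟩ := hv a
  have hdvd : g ∣ v i := by
    rw [← Ideal.mem_span_singleton, ← hg]
    exact Ideal.subset_span ⟨i, rfl⟩
  exact hi (eval_eq_zero_of_dvd_of_eval_eq_zero hdvd ha)

lemma HasNoCommonZero.exists_eq_C_mul [Finite ι] {u v : ι → k[X]} (hu : HasNoCommonZero u)
    (hv : HasNoCommonZero v) (h : ∀ i j, u i * v j = u j * v i) :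
    ∃ c : k, c ≠ 0 ∧ v = fun j ↦ C c * u j := by
  cases nonempty_fintype ι
  have h1 : (1 : k[X]) ∈ Ideal.span (Set.range u) := by rw [hu.span_eq_top]; trivial
  obtain ⟨a, ha⟩ := Ideal.mem_span_range_iff_exists_fun.mp h1
  have hw (j) : v j = (∑ i, a i * v i) * u j := by
    rw [← one_mul (v j), ← ha, Finset.sum_mul, Finset.sum_mul]
    exact Finset.sum_congr rfl fun i _ ↦ by rw [mul_assoc, h i j]; ring
  have hunit : IsUnit (∑ i, a i * v i) := by
    refine isUnit_of_forall_eval_ne_zero fun x hx ↦ ?_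
    obtain ⟨i, hi⟩ := hv x
    exact hi (by rw [hw, eval_mul, hx, zero_mul])
  obtain ⟨c, hc, hcw⟩ := isUnit_iff.mp hunit
  exact ⟨c, hc.ne_zero, funext fun j ↦ by rw [hcw, ← hw]⟩

end AlgClosed

section SymSq

variable {R S : Type*} [CommRing R] [CommRing S]

/-- The symmetric square of a pair of homogeneous coordinate vectors: the coefficients of the
binary quadratic form which is the product of the two linear forms that they define. -/
def symSq (u v : Fin 2 → R) : Fin 3 → R :=
  ![u 0 * v 0, u 0 * v 1 + u 1 * v 0, u 1 * v 1]

lemma symSq_ne_zero [NoZeroDivisors R] {u v : Fin 2 → R} (hu : u ≠ 0) (hv : v ≠ 0) :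
    symSq u v ≠ 0 := by
  intro h
  have h0 : u 0 * v 0 = 0 := congrFun h 0
  have h1 : u 0 * v 1 + u 1 * v 0 = 0 := congrFun h 1
  have h2 : u 1 * v 1 = 0 := congrFun h 2
  have hu' := Function.ne_iff.mp hu
  have hv' := Function.ne_iff.mp hv
  simp only [Fin.exists_fin_two, Pi.zero_apply] at hu' hv'
  rcases mul_eq_zero.mp h0 with h0 | h0 <;> rcases mul_eq_zero.mp h2 with h2 | h2 <;> simp_all

lemma symSq_smul (a b : R) (u v : Fin 2 → R) :
    symSq (a • u) (b • v) = (a * b) • symSq u v := by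
  ext i
  fin_cases i <;> simp [symSq] <;> ring

lemma map_symSq (φ : R →+* S) (u v : Fin 2 → R) (i : Fin 3) :
    φ (symSq u v i) = symSq (fun j ↦ φ (u j)) (fun j ↦ φ (v j)) i := by
  fin_cases i <;> simp [symSq]

lemma HasNoCommonZero.symSq [NoZeroDivisors R] {u v : Fin 2 → R[X]} (hu : HasNoCommonZero u)
    (hv : HasNoCommonZero v) : HasNoCommonZero (symSq u v) := by
  intro a
  obtain ⟨i, hi⟩ := Function.ne_iff.mp <|
    symSq_ne_zero (Function.ne_iff.mpr (hu a)) (Function.ne_iff.mpr (hv a))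
  exact ⟨i, by rw [← coe_evalRingHom, map_symSq]; exact hi⟩

lemma hasTopCoeff_symSq {u v : Fin 2 → R[X]} {D E : ℕ} {a b : Fin 2 → R}
    (hu : ∀ i, HasTopCoeff (u i) D (a i)) (hv : ∀ i, HasTopCoeff (v i) E (b i)) (i : Fin 3) :
    HasTopCoeff (symSq u v i) (D + E) (symSq a b i) := by
  fin_cases i
  · exact (hu 0).mul (hv 0)
  · exact ((hu 0).mul (hv 1)).add ((hu 1).mul (hv 0))
  · exact (hu 1).mul (hv 1)

lemma maxDegree_symSq [NoZeroDivisors R] {u v : Fin 2 → R[X]} (hu : u ≠ 0) (hv : v ≠ 0) :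
    maxDegree (symSq u v) = maxDegree u + maxDegree v :=
  maxDegree_eq_of_hasTopCoeff
    (hasTopCoeff_symSq (hasTopCoeff_maxDegree u) (hasTopCoeff_maxDegree v))
    (symSq_ne_zero (coeff_maxDegree_ne_zero hu) (coeff_maxDegree_ne_zero hv))

end SymSq

end PolynomialVectors

/-! ### The addition-subtraction formula -/

section AddSub

section CommRing

variable {R S : Type*} [CommRing R] [CommRing S] (W : WeierstrassCurve R)

/-- The values of the addition-and-subtraction map, which sends the symmetric square of the
`x`-coordinates of `P` and `Q` to that of the `x`-coordinates of `P + Q` and `P - Q`. -/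
noncomputable def addSubVec (v : Fin 3 → R) : Fin 3 → R :=
  fun i ↦ (W.addSubMap i).eval v

lemma addSubVec_eq (v : Fin 3 → R) :
    addSubVec W v =
      ![v 0 ^ 2 - W.b₄ * (v 0 * v 2) - W.b₆ * (v 1 * v 2) - W.b₈ * v 2 ^ 2,
        2 * (v 1 * v 0) + W.b₂ * (v 0 * v 2) + W.b₄ * (v 1 * v 2) + W.b₆ * v 2 ^ 2,
        v 1 ^ 2 - 4 * (v 0 * v 2)] := by
  ext i
  fin_cases i <;> simp [addSubVec, addSubMap] <;> ring

lemma addSubVec_ne_zero [IsReduced R] [W.IsElliptic] {v : Fin 3 → R} (hv : v ≠ 0) :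
    addSubVec W v ≠ 0 :=
  W.addSubMap_ne_zero hv

lemma addSubVec_smul (a : R) (v : Fin 3 → R) :
    addSubVec W (a • v) = a ^ 2 • addSubVec W v := by
  ext i
  fin_cases i <;> simp [addSubVec_eq] <;> ring

lemma map_addSubVec (φ : R →+* S) (v : Fin 3 → R) (i : Fin 3) :
    φ (addSubVec W v i) = addSubVec (W.map φ) (fun j ↦ φ (v j)) i := by
  fin_cases i <;> simp [addSubVec_eq, map_ofNat φ]

lemma HasNoCommonZero.addSubVec [IsReduced R] [W.IsElliptic] {v : Fin 3 → R[X]}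
    (hv : HasNoCommonZero v) : HasNoCommonZero (addSubVec (W.map C) v) := by
  intro a
  obtain ⟨i, hi⟩ := Function.ne_iff.mp (addSubVec_ne_zero W (Function.ne_iff.mpr (hv a)))
  have hW : (W.map C).map (evalRingHom a) = W := by ext <;> simp
  exact ⟨i, by rw [← coe_evalRingHom, map_addSubVec, hW]; exact hi⟩

lemma hasTopCoeff_addSubVec {v : Fin 3 → R[X]} {D : ℕ} {a : Fin 3 → R}
    (h : ∀ i, HasTopCoeff (v i) D (a i)) (i : Fin 3) :
    HasTopCoeff (addSubVec (W.map C) v i) (2 * D) (addSubVec W a i) := by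
  have hmul (i j) : HasTopCoeff (v i * v j) (2 * D) (a i * a j) := two_mul D ▸ (h i).mul (h j)
  have hsq (i) : HasTopCoeff (v i ^ 2) (2 * D) (a i ^ 2) := (h i).pow 2
  rw [addSubVec_eq, addSubVec_eq, map_b₂, map_b₄, map_b₆, map_b₈, ← map_ofNat C 2,
    ← map_ofNat C 4]
  fin_cases i
  · exact (((hsq 0).sub ((hmul 0 2).C_mul W.b₄)).sub ((hmul 1 2).C_mul W.b₆)).sub
      ((hsq 2).C_mul W.b₈)
  · exact ((((hmul 1 0).C_mul 2).add ((hmul 0 2).C_mul W.b₂)).add ((hmul 1 2).C_mul W.b₄)).add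
      ((hsq 2).C_mul W.b₆)
  · exact (hsq 1).sub ((hmul 0 2).C_mul 4)

lemma maxDegree_addSubVec [IsReduced R] [W.IsElliptic] {v : Fin 3 → R[X]} (hv : v ≠ 0) :
    maxDegree (addSubVec (W.map C) v) = 2 * maxDegree v :=
  maxDegree_eq_of_hasTopCoeff (hasTopCoeff_addSubVec W (hasTopCoeff_maxDegree v))
    (addSubVec_ne_zero W (coeff_maxDegree_ne_zero hv))

lemma addSubVec_sym2x_zero_left (Q : W.toAffine.Point) :
    addSubVec W ((0 : W.toAffine.Point).sym2x Q) = Q.sym2x Q := by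
  rw [addSubVec_eq]
  rcases Q with _ | ⟨x, y, h⟩
  · simp [Affine.Point.sym2x, Affine.Point.xRep]
  · rw [Affine.Point.sym2x_zero_some, Affine.Point.sym2x_some_some]
    apply Matrix.vec3_eq <;> simp <;> ring

end CommRing

section Field

variable {K : Type*} [Field K] [DecidableEq K] {W : WeierstrassCurve K}

lemma exists_addSubVec_sym2x_self (P : W.toAffine.Point) :
    ∃ c : K, addSubVec W (P.sym2x P) = c • (P + P).sym2x 0 := by
  rcases P with _ | ⟨x, y, h⟩
  · exact ⟨1, by
      rw [← Affine.Point.zero_def, add_zero, one_smul, addSubVec_sym2x_zero_left]⟩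
  rw [Affine.Point.sym2x_some_some, addSubVec_eq]
  have heq := (Affine.equation_iff ..).mp h.1
  by_cases hy : y = W.toAffine.negY x y
  · refine ⟨x ^ 4 - W.b₄ * x ^ 2 - 2 * W.b₆ * x - W.b₈, ?_⟩
    rw [Affine.Point.add_self_of_Y_eq hy, Affine.Point.sym2x_zero_zero, Matrix.smul_vec3]
    rw [Affine.negY] at hy
    apply Matrix.vec3_eq
    · simp; ring
    · simp [b₂, b₄, b₆]
      linear_combination (-4) * heq + (2 * y + W.a₁ * x + W.a₃) * hy
    · simp; ring
  · refine ⟨(y - W.toAffine.negY x y) ^ 2, ?_⟩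
    have hslope : W.toAffine.slope x x y y * (y - W.toAffine.negY x y) =
        3 * x ^ 2 + 2 * W.a₂ * x + W.a₄ - W.a₁ * y := by
      rw [Affine.slope_of_Y_ne rfl hy, div_mul_cancel₀ _ (sub_ne_zero.mpr hy)]
    rw [Affine.Point.add_self_of_Y_ne hy, Affine.Point.sym2x_some_zero, Matrix.smul_vec3]
    generalize W.toAffine.slope x x y y = ℓ at *
    rw [Affine.negY] at *
    apply Matrix.vec3_eq
    · simp [b₄, b₆, b₈]
      grind
    · simp [b₂, b₄, b₆]
      linear_combination (-4) * heq
    · simp; ring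

lemma exists_addSubVec_sym2x_some_of_X_ne {x₁ x₂ y₁ y₂ : K}
    (h₁ : W.toAffine.Nonsingular x₁ y₁) (h₂ : W.toAffine.Nonsingular x₂ y₂) (hx : x₁ ≠ x₂) :
    ∃ c : K, addSubVec W ((Affine.Point.some x₁ y₁ h₁).sym2x (.some x₂ y₂ h₂)) =
      c • (Affine.Point.some x₁ y₁ h₁ + .some x₂ y₂ h₂).sym2x
        (.some x₁ y₁ h₁ - .some x₂ y₂ h₂) := by
  have e₁ := (Affine.equation_iff ..).mp h₁.1
  have e₂ := (Affine.equation_iff ..).mp h₂.1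
  have hx' := sub_ne_zero.mpr hx
  refine ⟨(x₁ - x₂) ^ 2, ?_⟩
  rw [sub_eq_add_neg (Affine.Point.some x₁ y₁ h₁), Affine.Point.neg_some,
    Affine.Point.add_of_X_ne hx, Affine.Point.add_of_X_ne hx, Affine.Point.sym2x_some_some,
    Affine.Point.sym2x_some_some, addSubVec_eq, Matrix.smul_vec3]
  have hadd : W.toAffine.slope x₁ x₂ y₁ y₂ * (x₁ - x₂) = y₁ - y₂ := by
    rw [Affine.slope_of_X_ne hx, div_mul_cancel₀ _ hx']
  have hsub : W.toAffine.slope x₁ x₂ y₁ (W.toAffine.negY x₂ y₂) * (x₁ - x₂) =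
      y₁ - W.toAffine.negY x₂ y₂ := by
    rw [Affine.slope_of_X_ne hx, div_mul_cancel₀ _ hx']
  generalize W.toAffine.slope x₁ x₂ y₁ y₂ = ℓ at *
  generalize W.toAffine.slope x₁ x₂ y₁ (W.toAffine.negY x₂ y₂) = m at *
  rw [Affine.negY] at hsub
  have haddX : (x₁ - x₂) ^ 2 * W.toAffine.addX x₁ x₂ ℓ =
      (y₁ - y₂) ^ 2 + W.a₁ * (y₁ - y₂) * (x₁ - x₂) - (W.a₂ + x₁ + x₂) * (x₁ - x₂) ^ 2 := by
    rw [← hadd, Affine.addX]; ring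
  have hsubX : (x₁ - x₂) ^ 2 * W.toAffine.addX x₁ x₂ m =
      (y₁ + y₂ + W.a₁ * x₂ + W.a₃) ^ 2 +
        W.a₁ * (y₁ + y₂ + W.a₁ * x₂ + W.a₃) * (x₁ - x₂) -
        (W.a₂ + x₁ + x₂) * (x₁ - x₂) ^ 2 := by
    rw [show y₁ + y₂ + W.a₁ * x₂ + W.a₃ = m * (x₁ - x₂) by rw [hsub]; ring, Affine.addX]; ring
  clear hadd hsub
  apply Matrix.vec3_eq
  · refine mul_left_cancel₀ (pow_ne_zero 2 hx') ?_
    trans ((x₁ - x₂) ^ 2 * W.toAffine.addX x₁ x₂ ℓ) * ((x₁ - x₂) ^ 2 * W.toAffine.addX x₁ x₂ m)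
    · rw [haddX, hsubX]
      clear haddX hsubX
      simp [b₄, b₆, b₈]
      grind
    · rw [smul_eq_mul]; ring
  · rw [smul_eq_mul, mul_add, haddX, hsubX]
    simp [b₂, b₄, b₆]
    linear_combination (-2) * e₁ - 2 * e₂
  · simp; ring

lemma exists_addSubVec_sym2x (P Q : W.toAffine.Point) :
    ∃ c : K, addSubVec W (P.sym2x Q) = c • (P + Q).sym2x (P - Q) := by
  rcases P with _ | ⟨x₁, y₁, h₁⟩
  · refine ⟨1, ?_⟩
    rw [← Affine.Point.zero_def, addSubVec_sym2x_zero_left, zero_add, zero_sub,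
      Affine.Point.sym2x_neg_right, one_smul]
  rcases Q with _ | ⟨x₂, y₂, h₂⟩
  · refine ⟨1, ?_⟩
    rw [← Affine.Point.zero_def, Affine.Point.sym2x_comm, addSubVec_sym2x_zero_left, add_zero,
      sub_zero, one_smul]
  by_cases hx : x₁ = x₂
  · subst hx
    rcases Affine.Point.X_eq_iff.mp (rfl : x₁ = x₁) with h | h <;> rw [h]
    · rw [sub_self]
      exact exists_addSubVec_sym2x_self _
    · obtain ⟨c, hc⟩ := exists_addSubVec_sym2x_self (Affine.Point.some x₁ y₂ h₂)
      exact ⟨c, by rw [Affine.Point.sym2x_neg_left, hc, neg_add_cancel, ← neg_add',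
        Affine.Point.sym2x_neg_right, Affine.Point.sym2x_comm]⟩
  · exact exists_addSubVec_sym2x_some_of_X_ne h₁ h₂ hx

end Field

end AddSub

/-! ### Functions satisfying the parallelogram law -/

section QuadraticFunctions

/-- The parallelogram law for an integer-valued function on a commutative group. It makes the
function a quadratic form over `ℤ`. -/
def ParallelogramLaw {G : Type*} [AddCommGroup G] (d : G → ℤ) : Prop :=
  ∀ x y, d (x + y) + d (x - y) = 2 * d x + 2 * d y

namespace ParallelogramLaw

variable {G : Type*} [AddCommGroup G] {d : G → ℤ}

protected lemma map_zero (hd : ParallelogramLaw d) : d 0 = 0 := by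
  have := hd 0 0
  rw [add_zero, sub_zero] at this
  omega

/-- The bilinear form `(x, z) ↦ d (x + z) - d x - d z` of a function `d` that satisfies the
parallelogram law, as a homomorphism in `x`. -/
def polarHom (hd : ParallelogramLaw d) (z : G) : G →+ ℤ where
  toFun x := d (x + z) - d x - d z
  map_zero' := by rw [zero_add, hd.map_zero]; ring
  map_add' x y := by
    have h1 := hd (x + z) y
    have h2 := hd (x - y) z
    have h3 := hd x (y + z)
    have h4 := hd x y
    rw [show x + z - y = x - y + z by abel] at h1
    rw [show x - (y + z) = x - y - z by abel] at h3
    rw [show x + z + y = x + y + z by abel] at h1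
    rw [show x + (y + z) = x + y + z by abel] at h3
    linarith

lemma polarHom_apply (hd : ParallelogramLaw d) (x z : G) :
    hd.polarHom z x = d (x + z) - d x - d z := rfl

lemma polarHom_comm (hd : ParallelogramLaw d) (x z : G) :
    hd.polarHom z x = hd.polarHom x z := by
  rw [polarHom_apply, polarHom_apply, add_comm]
  ring

lemma polarHom_self (hd : ParallelogramLaw d) (x : G) : hd.polarHom x x = 2 * d x := by
  have := hd x x
  rw [sub_self, hd.map_zero] at this
  rw [polarHom_apply]
  omega

protected lemma map_add (hd : ParallelogramLaw d) (x y : G) :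
    d (x + y) = d x + d y + hd.polarHom y x := by
  rw [polarHom_apply]; ring

protected lemma map_sub (hd : ParallelogramLaw d) (x y : G) :
    d (x - y) = d x + d y - hd.polarHom y x := by
  have := hd x y
  rw [polarHom_apply]; linarith

protected lemma map_zsmul (hd : ParallelogramLaw d) (m : ℤ) (x : G) : d (m • x) = m ^ 2 * d x := by
  have h : 2 * d (m • x) = 2 * (m ^ 2 * d x) := by
    rw [← hd.polarHom_self, map_zsmul, polarHom_comm, map_zsmul, hd.polarHom_self]
    simp only [smul_eq_mul]; ring
  linarith

lemma polarHom_eq_zero (hd : ParallelogramLaw d) (h0 : ∀ x, 0 ≤ d x) {x : G} (hx : d x = 0)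
    (y : G) : hd.polarHom y x = 0 := by
  have key (m : ℤ) : 0 ≤ d y + m * hd.polarHom y x := by
    have := h0 (m • x + y)
    rw [hd.map_add, hd.map_zsmul, hx, map_zsmul, smul_eq_mul] at this
    linarith
  by_contra hne
  have h1 := key (-(d y + 1) * hd.polarHom y x)
  have h2 : 1 ≤ hd.polarHom y x ^ 2 := by
    have : 0 < hd.polarHom y x ^ 2 := by positivity
    omega
  nlinarith [h0 y]

lemma polarHom_zsmul (hd : ParallelogramLaw d) (m : ℤ) (x y : G) :
    hd.polarHom (m • y) x = m * hd.polarHom y x := by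
  rw [polarHom_comm, map_zsmul, polarHom_comm, smul_eq_mul]

variable {q : ℤ} {φ : G →+ G} {e : G}

lemma polarHom_map (hd : ParallelogramLaw d) (hφ : ∀ x, d (φ x) = q * d x) (x y : G) :
    hd.polarHom (φ y) (φ x) = q * hd.polarHom y x := by
  rw [polarHom_apply, polarHom_apply, ← map_add, hφ, hφ, hφ]; ring

lemma map_charpoly_eq_zero (hd : ParallelogramLaw d) (hφ : ∀ x, d (φ x) = q * d x)
    (he : d e = 1) (h2 : d (φ (φ e) - e) = d (φ e - e) * d (φ e + e)) :
    d (φ (φ e) - (hd.polarHom e (φ e)) • φ e + q • e) = 0 := by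
  rw [hd.map_sub, hd.map_sub, hd.map_add, hφ, hφ, he] at h2
  have h12 : hd.polarHom (φ e) (φ (φ e)) = q * hd.polarHom e (φ e) := hd.polarHom_map hφ _ _
  rw [hd.map_add, hd.map_sub, hd.map_zsmul, hd.map_zsmul, hφ, hφ, he, hd.polarHom_zsmul,
    hd.polarHom_zsmul, map_sub, map_zsmul, h12, smul_eq_mul]
  linear_combination (-q) * h2

lemma polarHom_recurrence (hd : ParallelogramLaw d) (h0 : ∀ x, 0 ≤ d x)
    (hφ : ∀ x, d (φ x) = q * d x)
    (he : d e = 1) (h2 : d (φ (φ e) - e) = d (φ e - e) * d (φ e + e)) (n : ℕ) :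
    hd.polarHom e (φ^[n + 2] e) =
      hd.polarHom e (φ e) * hd.polarHom e (φ^[n + 1] e) - q * hd.polarHom e (φ^[n] e) := by
  set v := φ (φ e) - (hd.polarHom e (φ e)) • φ e + q • e with hv
  have hvn (n : ℕ) : d (φ^[n] v) = 0 := by
    induction n with
    | zero => exact hd.map_charpoly_eq_zero hφ he h2
    | succ n ih => rw [Function.iterate_succ_apply', hφ, ih, mul_zero]
  have h := hd.polarHom_eq_zero h0 (hvn n) e
  rw [hv, iterate_map_add, iterate_map_sub, iterate_map_zsmul, iterate_map_zsmul, map_add,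
    map_sub, map_zsmul, map_zsmul, ← Function.iterate_succ_apply,
    ← Function.iterate_succ_apply, ← Function.iterate_succ_apply, smul_eq_mul, smul_eq_mul] at h
  linarith

lemma sq_polarHom_le (hd : ParallelogramLaw d) (h0 : ∀ x, 0 ≤ d x)
    (hφ : ∀ x, d (φ x) = q * d x) (he : d e = 1) :
    hd.polarHom e (φ e) ^ 2 ≤ 4 * q := by
  have := h0 ((2 : ℤ) • φ e - (hd.polarHom e (φ e)) • e)
  rw [hd.map_sub, hd.map_zsmul, hd.map_zsmul, hφ, he, map_zsmul,
    hd.polarHom_zsmul] at this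
  simp only [smul_eq_mul] at this
  linarith

lemma map_iterate_sub (hd : ParallelogramLaw d) (hφ : ∀ x, d (φ x) = q * d x) (he : d e = 1)
    (n : ℕ) : d (φ^[n] e - e) = q ^ n + 1 - hd.polarHom e (φ^[n] e) := by
  have : d (φ^[n] e) = q ^ n := by
    induction n with
    | zero => simpa using he
    | succ n ih => rw [Function.iterate_succ_apply', hφ, ih]; ring
  rw [hd.map_sub, this, he]

end ParallelogramLaw

end QuadraticFunctions

/-! ### The degree of the `x`-coordinate -/

section XDegree

instance {R A : Type*} [CommRing R] [CommRing A] [Algebra R A] (W : WeierstrassCurve R)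
    [W.IsElliptic] : (W⁄A).IsElliptic :=
  inferInstanceAs (W.map _).IsElliptic

variable {F : Type*} [Field F] {W : WeierstrassCurve F} {k : Type*} [Field k]
  {K : Type*} [Field K] [Algebra F K] [Algebra k[X] K]

/-- The polynomials `u 0` and `u 1` without common zero are homogeneous coordinates of the
`x`-coordinate of the point `P`. -/
def IsXRep (P : (W⁄K).toAffine.Point) (u : Fin 2 → k[X]) : Prop :=
  HasNoCommonZero u ∧
    algebraMap k[X] K (u 0) * P.xRep 1 = algebraMap k[X] K (u 1) * P.xRep 0

lemma IsXRep.exists_smul_eq {P : (W⁄K).toAffine.Point} {u : Fin 2 → k[X]} (h : IsXRep P u) :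
    ∃ c : K, (fun i ↦ algebraMap k[X] K (u i)) = c • P.xRep := by
  obtain ⟨-, h⟩ := h
  rcases P with _ | ⟨x, y, hxy⟩
  · rw [← Affine.Point.zero_def, Affine.Point.xRep_zero] at *
    refine ⟨algebraMap k[X] K (u 0), ?_⟩
    have h1 : algebraMap k[X] K (u 1) = 0 := by simpa using h.symm
    ext i; fin_cases i <;> simp [h1]
  · rw [Affine.Point.xRep_some] at *
    refine ⟨algebraMap k[X] K (u 1), ?_⟩
    ext i; fin_cases i <;> simp_all

lemma baseChange_map_C_map_algebraMap [Algebra F k] [IsScalarTower F k[X] K]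
    (W : WeierstrassCurve F) : ((W⁄k).map C).map (algebraMap k[X] K) = W⁄K := by
  rw [WeierstrassCurve.map_map, baseChange, baseChange, WeierstrassCurve.map_map,
    IsScalarTower.algebraMap_eq F k[X] K, RingHom.comp_assoc]
  rfl

variable [FaithfulSMul k[X] K] [IsAlgClosed k]

lemma IsXRep.maxDegree_eq {P : (W⁄K).toAffine.Point} {u v : Fin 2 → k[X]} (hu : IsXRep P u)
    (hv : IsXRep P v) : maxDegree u = maxDegree v := by
  obtain ⟨a, ha⟩ := hu.exists_smul_eq
  obtain ⟨b, hb⟩ := hv.exists_smul_eq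
  simp only [funext_iff, Pi.smul_apply, smul_eq_mul] at ha hb
  obtain ⟨c, hc, rfl⟩ := hu.1.exists_eq_C_mul hv.1 fun i j ↦
    FaithfulSMul.algebraMap_injective k[X] K <| by
      rw [map_mul, map_mul, ha, ha, hb, hb]; ring
  exact (maxDegree_C_mul u hc).symm

section AddSub

variable [Algebra F k] [IsScalarTower F k[X] K]

variable [DecidableEq K] [W.IsElliptic] {P Q : (W⁄K).toAffine.Point} {u₁ u₂ u₃ u₄ : Fin 2 → k[X]}

lemma IsXRep.exists_addSubVec_eq (h₁ : IsXRep P u₁) (h₂ : IsXRep Q u₂) (h₃ : IsXRep (P + Q) u₃)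
    (h₄ : IsXRep (P - Q) u₄) :
    ∃ c : k, c ≠ 0 ∧ addSubVec ((W⁄k).map C) (symSq u₁ u₂) = fun i ↦ C c * symSq u₃ u₄ i := by
  obtain ⟨c₁, e₁⟩ := h₁.exists_smul_eq
  obtain ⟨c₂, e₂⟩ := h₂.exists_smul_eq
  obtain ⟨c₃, e₃⟩ := h₃.exists_smul_eq
  obtain ⟨c₄, e₄⟩ := h₄.exists_smul_eq
  obtain ⟨c, hc⟩ := exists_addSubVec_sym2x P Q
  have hprod (i) : algebraMap k[X] K (symSq u₃ u₄ i) =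
      (c₃ * c₄) * (P + Q).sym2x (P - Q) i := by
    rw [map_symSq, e₃, e₄, symSq_smul]; rfl
  have haddSub (i) : algebraMap k[X] K (addSubVec ((W⁄k).map C) (symSq u₁ u₂) i) =
      (c₁ * c₂) ^ 2 * (c * (P + Q).sym2x (P - Q) i) := by
    simp_rw [map_addSubVec, map_symSq, e₁, e₂, symSq_smul, baseChange_map_C_map_algebraMap]
    change addSubVec _ ((c₁ * c₂) • P.sym2x Q) i = _
    rw [addSubVec_smul, hc]; rfl
  refine (h₃.1.symSq h₄.1).exists_eq_C_mul ((h₁.1.symSq h₂.1).addSubVec (W⁄k))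
    fun i j ↦ FaithfulSMul.algebraMap_injective k[X] K ?_
  rw [map_mul, map_mul, hprod, hprod, haddSub, haddSub]
  ring

lemma IsXRep.maxDegree_add (h₁ : IsXRep P u₁) (h₂ : IsXRep Q u₂) (h₃ : IsXRep (P + Q) u₃)
    (h₄ : IsXRep (P - Q) u₄) :
    maxDegree u₃ + maxDegree u₄ = 2 * maxDegree u₁ + 2 * maxDegree u₂ := by
  obtain ⟨c, hc, h⟩ := h₁.exists_addSubVec_eq h₂ h₃ h₄
  rw [← maxDegree_symSq h₃.1.ne_zero h₄.1.ne_zero, ← maxDegree_C_mul _ hc, ← h,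
    maxDegree_addSubVec _ (h₁.1.symSq h₂.1).ne_zero, maxDegree_symSq h₁.1.ne_zero h₂.1.ne_zero,
    mul_add]

end AddSub

variable (k) in
open scoped Classical in
/-- The degree of the `x`-coordinate of a point as a rational function, with the value `0` if the
`x`-coordinate is not in the function field of the line. -/
noncomputable def xDegree (P : (W⁄K).toAffine.Point) : ℕ :=
  if h : ∃ u : Fin 2 → k[X], IsXRep P u then maxDegree h.choose else 0

lemma IsXRep.xDegree_eq {P : (W⁄K).toAffine.Point} {u : Fin 2 → k[X]} (h : IsXRep P u) :
    xDegree k P = maxDegree u := by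
  have h' : ∃ u : Fin 2 → k[X], IsXRep P u := ⟨u, h⟩
  rw [xDegree, dif_pos h']
  exact h'.choose_spec.maxDegree_eq h

end XDegree

/-! ### The function field -/

section FunctionField

lemma equation_baseChange_iff {R A : Type*} [CommRing R] [CommRing A] [Algebra R A]
    (W : WeierstrassCurve R) (u v : A) : (W⁄A).toAffine.Equation u v ↔
      v ^ 2 + algebraMap R A W.a₁ * u * v + algebraMap R A W.a₃ * v =
        u ^ 3 + algebraMap R A W.a₂ * u ^ 2 + algebraMap R A W.a₄ * u + algebraMap R A W.a₆ :=
  Affine.equation_iff ..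

lemma negY_baseChange {R A : Type*} [CommRing R] [CommRing A] [Algebra R A]
    (W : WeierstrassCurve R) (u v : A) : (W⁄A).toAffine.negY u v =
      -v - algebraMap R A W.a₁ * u - algebraMap R A W.a₃ :=
  rfl

lemma baseChange_baseChange {R : Type*} [CommRing R] (W : WeierstrassCurve R) (A B : Type*)
    [CommRing A] [Algebra R A] [CommRing B] [Algebra R B] [Algebra A B] [IsScalarTower R A B] :
    (W⁄A)⁄B = W⁄B := by
  rw [baseChange, baseChange, WeierstrassCurve.map_map, ← IsScalarTower.algebraMap_eq, baseChange]

instance {R : Type*} [CommRing R] (W : WeierstrassCurve R) :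
    Module.Finite R[X] W.toAffine.CoordinateRing :=
  .of_basis (Affine.CoordinateRing.basis W.toAffine)

variable {F : Type*} [Field F] (W : WeierstrassCurve F) (k : Type*) [Field k] [Algebra F k]

/-- The function field of the base change of a Weierstrass curve over `F` to `k`, as a type synonym
that remembers `W`, so that it is an algebra over both `F` and `k`. -/
def FunField : Type _ := (W⁄k).toAffine.FunctionField

namespace FunField

noncomputable instance : Field (FunField W k) :=
  inferInstanceAs (Field (W⁄k).toAffine.FunctionField)

noncomputable instance : DecidableEq (FunField W k) := Classical.decEq _

noncomputable instance : Algebra F (FunField W k) :=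
  inferInstanceAs (Algebra F (W⁄k).toAffine.FunctionField)

noncomputable instance : Algebra k (FunField W k) :=
  inferInstanceAs (Algebra k (W⁄k).toAffine.FunctionField)

noncomputable instance : Algebra k[X] (FunField W k) :=
  inferInstanceAs (Algebra k[X] (W⁄k).toAffine.FunctionField)

noncomputable instance : Algebra (W⁄k).toAffine.CoordinateRing (FunField W k) :=
  inferInstanceAs (Algebra (W⁄k).toAffine.CoordinateRing (W⁄k).toAffine.FunctionField)

instance : IsFractionRing (W⁄k).toAffine.CoordinateRing (FunField W k) :=
  inferInstanceAs (IsFractionRing (W⁄k).toAffine.CoordinateRing (W⁄k).toAffine.FunctionField)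

instance : IsScalarTower F k (FunField W k) :=
  inferInstanceAs (IsScalarTower F k (W⁄k).toAffine.FunctionField)

instance : IsScalarTower F k[X] (FunField W k) :=
  inferInstanceAs (IsScalarTower F k[X] (W⁄k).toAffine.FunctionField)

instance : IsScalarTower k k[X] (FunField W k) :=
  inferInstanceAs (IsScalarTower k k[X] (W⁄k).toAffine.FunctionField)

instance : IsScalarTower k[X] (W⁄k).toAffine.CoordinateRing (FunField W k) :=
  inferInstanceAs
    (IsScalarTower k[X] (W⁄k).toAffine.CoordinateRing (W⁄k).toAffine.FunctionField)

instance : FaithfulSMul k[X] (FunField W k) :=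
  inferInstanceAs (FaithfulSMul k[X] (W⁄k).toAffine.FunctionField)

/-- The coordinate function `x` of the curve. -/
noncomputable def x : FunField W k := algebraMap k[X] _ X

/-- The coordinate function `y` of the curve. -/
noncomputable def y : FunField W k := algebraMap _ _ (Affine.CoordinateRing.mk (W⁄k).toAffine Y)

variable {W k}

lemma algebraMap_eq_algebraMap_C (r : F) :
    algebraMap F (FunField W k) r = algebraMap k[X] _ (C (algebraMap F k r)) :=
  IsScalarTower.algebraMap_apply F k[X] (FunField W k) r

lemma algebraMap_polynomial_injective : Function.Injective (algebraMap k[X] (FunField W k)) :=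
  FaithfulSMul.algebraMap_injective _ _

lemma algebraMap_coordinateRing_injective :
    Function.Injective (algebraMap (W⁄k).toAffine.CoordinateRing (FunField W k)) :=
  IsFractionRing.injective _ _

lemma aeval_x (f : k[X]) : aeval (x W k) f = algebraMap k[X] _ f := by
  rw [x, aeval_algebraMap_apply, aeval_X_left_apply]

lemma transcendental_x : Transcendental k (x W k) := by
  rw [transcendental_iff]
  intro f hf
  rwa [aeval_x, map_eq_zero_iff _ algebraMap_polynomial_injective] at hf

variable (W k) in
lemma equation_x_y : (W⁄(FunField W k)).toAffine.Equation (x W k) (y W k) := by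
  have h : algebraMap _ (FunField W k)
      (Affine.CoordinateRing.mk (W⁄k).toAffine (W⁄k).toAffine.polynomial) = 0 := by
    rw [Affine.CoordinateRing.mk, AdjoinRoot.mk_self, map_zero]
  have hC (f : k[X]) : algebraMap _ (FunField W k)
      (Affine.CoordinateRing.mk (W⁄k).toAffine (C f)) = algebraMap k[X] _ f :=
    (IsScalarTower.algebraMap_apply k[X] (W⁄k).toAffine.CoordinateRing (FunField W k) f).symm
  simp only [Affine.polynomial, map_sub, map_add, map_mul, map_pow, hC] at h
  rw [← baseChange_baseChange W k, equation_baseChange_iff, x, y]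
  simp only [IsScalarTower.algebraMap_apply k k[X] (FunField W k), algebraMap_eq]
  linear_combination h

section Eval

variable {L : Type*} [Field L] [Algebra F L] [Algebra k L] [IsScalarTower F k L] {u v : L}

/-- The evaluation of regular functions at the point `(u, v)`. -/
noncomputable def evalRing (h : (W⁄L).toAffine.Equation u v) :
    (W⁄k).toAffine.CoordinateRing →+* L :=
  AdjoinRoot.lift (eval₂RingHom (algebraMap k L) u) v (by
    rw [← baseChange_baseChange W k, equation_baseChange_iff] at h
    simp only [Affine.polynomial, eval₂_sub, eval₂_add, eval₂_mul, eval₂_pow, eval₂_C, eval₂_X,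
      coe_eval₂RingHom]
    linear_combination h)

variable (h : (W⁄L).toAffine.Equation u v)

lemma evalRing_algebraMap (f : k[X]) :
    evalRing h (algebraMap k[X] (W⁄k).toAffine.CoordinateRing f) = aeval u f :=
  AdjoinRoot.lift_of _

lemma evalRing_mk_Y : evalRing h (Affine.CoordinateRing.mk (W⁄k).toAffine Y) = v :=
  AdjoinRoot.lift_root _

variable (hu : Transcendental k u)

include hu in
lemma evalRing_injective : Function.Injective (evalRing (k := k) h) := by
  rw [RingHom.injective_iff_ker_eq_bot]
  refine Ideal.eq_bot_of_comap_eq_bot (R := k[X]) ((Submodule.eq_bot_iff _).mpr fun f hf ↦ ?_)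
  rw [Ideal.mem_comap, RingHom.mem_ker, evalRing_algebraMap] at hf
  exact transcendental_iff.mp hu f hf

/-- The homomorphism on the function field given by evaluation at a point `(u, v)` with
transcendental `u`, that is, the pullback of functions along a nonconstant map to the curve. -/
noncomputable def evalHom : FunField W k →ₐ[F] L where
  __ := IsFractionRing.lift (K := FunField W k) (evalRing_injective h hu)
  commutes' r := by
    rw [algebraMap_eq_algebraMap_C,
      IsScalarTower.algebraMap_apply k[X] (W⁄k).toAffine.CoordinateRing (FunField W k)]
    refine (IsFractionRing.lift_algebraMap (evalRing_injective h hu) _).trans ?_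
    rw [evalRing_algebraMap, aeval_C, ← IsScalarTower.algebraMap_apply]

lemma evalHom_algebraMap_coordinateRing (s : (W⁄k).toAffine.CoordinateRing) :
    evalHom h hu (algebraMap _ _ s) = evalRing h s :=
  IsFractionRing.lift_algebraMap (evalRing_injective h hu) _

lemma evalHom_algebraMap (f : k[X]) : evalHom h hu (algebraMap k[X] _ f) = aeval u f := by
  rw [IsScalarTower.algebraMap_apply k[X] (W⁄k).toAffine.CoordinateRing,
    evalHom_algebraMap_coordinateRing, evalRing_algebraMap]

lemma evalHom_x : evalHom h hu (x W k) = u := by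
  rw [x, evalHom_algebraMap, aeval_X]

lemma evalHom_y : evalHom h hu (y W k) = v := by
  rw [y, evalHom_algebraMap_coordinateRing, evalRing_mk_Y]

end Eval

variable (W k) in
/-- The automorphism of the function field induced by the negation of points. -/
noncomputable def negHom : FunField W k →ₐ[F] FunField W k :=
  evalHom ((Affine.equation_neg _ _).mpr (equation_x_y W k)) transcendental_x

lemma negHom_algebraMap (f : k[X]) : negHom W k (algebraMap k[X] _ f) = algebraMap k[X] _ f := by
  rw [negHom, evalHom_algebraMap, aeval_x]

lemma negHom_x : negHom W k (x W k) = x W k := negHom_algebraMap X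

lemma negHom_y :
    negHom W k (y W k) = (W⁄(FunField W k)).toAffine.negY (x W k) (y W k) :=
  evalHom_y _ _

lemma algebraMap_smul_basis (p q : k[X]) :
    algebraMap _ (FunField W k) (p • 1 + q • Affine.CoordinateRing.mk (W⁄k).toAffine Y) =
      algebraMap k[X] _ p + algebraMap k[X] _ q * y W k := by
  rw [map_add, Algebra.smul_def, Algebra.smul_def, map_mul, map_one, mul_one, map_mul, ← y,
    ← IsScalarTower.algebraMap_apply, ← IsScalarTower.algebraMap_apply]

lemma exists_algebraMap_mul_eq (z : FunField W k) : ∃ N p q : k[X], N ≠ 0 ∧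
    algebraMap k[X] _ N * z = algebraMap k[X] _ p + algebraMap k[X] _ q * y W k := by
  obtain ⟨r, s, hs, rfl⟩ := IsFractionRing.div_surjective (A := (W⁄k).toAffine.CoordinateRing) z
  obtain ⟨N, hN, t, hst⟩ := (Algebra.IsIntegral.isIntegral (R := k[X]) s).isAlgebraic
    |>.exists_nonzero_dvd hs
  obtain ⟨p, q, hpq⟩ := Affine.CoordinateRing.exists_smul_basis_eq (r * t)
  refine ⟨N, p, q, hN, ?_⟩
  have hs' : algebraMap _ (FunField W k) s ≠ 0 :=
    (map_ne_zero_iff _ algebraMap_coordinateRing_injective).mpr (nonZeroDivisors.ne_zero hs)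
  rw [← algebraMap_smul_basis, hpq,
    IsScalarTower.algebraMap_apply k[X] (W⁄k).toAffine.CoordinateRing, hst, map_mul, map_mul]
  field_simp

variable [W.IsElliptic]

-- `y = -y - a₁x - a₃` forces `2 = a₁ = a₃ = 0`, and then the discriminant vanishes.
lemma y_ne_negY : y W k ≠ (W⁄(FunField W k)).toAffine.negY (x W k) (y W k) := by
  intro h
  rw [negY_baseChange, algebraMap_eq_algebraMap_C, algebraMap_eq_algebraMap_C] at h
  have hzero : algebraMap (W⁄k).toAffine.CoordinateRing (FunField W k)
      ((C (algebraMap F k W.a₁) * X + C (algebraMap F k W.a₃) : k[X]) • 1 +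
        (2 : k[X]) • Affine.CoordinateRing.mk (W⁄k).toAffine Y) = 0 := by
    rw [algebraMap_smul_basis, map_add, map_mul, map_ofNat, ← x]
    linear_combination h
  rw [map_eq_zero_iff _ algebraMap_coordinateRing_injective] at hzero
  obtain ⟨hlin, htwo⟩ := Affine.CoordinateRing.smul_basis_eq_zero hzero
  have ha₁ : (W⁄k).a₁ = 0 := by simpa using congrArg (coeff · 1) hlin
  have ha₃ : (W⁄k).a₃ = 0 := by simpa using congrArg (coeff · 0) hlin
  rw [← map_ofNat C, C_eq_zero] at htwo
  refine (W⁄k).isUnit_Δ.ne_zero ?_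
  rw [Δ, b₂, b₄, b₆, b₈, ha₁, ha₃]
  linear_combination (144 * (W⁄k).a₂ * (W⁄k).a₆ * (W⁄k).a₄ + 8 * (W⁄k).a₂ ^ 2 * (W⁄k).a₄ ^ 2 -
    32 * (W⁄k).a₂ ^ 3 * (W⁄k).a₆ - 216 * (W⁄k).a₆ ^ 2 - 32 * (W⁄k).a₄ ^ 3) * htwo

lemma exists_isCoprime_of_negHom_eq {z : FunField W k} (hz : negHom W k z = z) :
    ∃ f g : k[X], IsCoprime f g ∧ algebraMap k[X] _ f = algebraMap k[X] _ g * z := by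
  classical
  obtain ⟨N, p, q, hN, h⟩ := exists_algebraMap_mul_eq z
  have hneg := congrArg (negHom W k) h
  rw [map_add, map_mul, map_mul, hz, negHom_algebraMap, negHom_algebraMap, negHom_algebraMap,
    negHom_y, h] at hneg
  have hq : algebraMap k[X] (FunField W k) q = 0 :=
    (mul_eq_mul_left_iff.mp (add_left_cancel hneg)).resolve_left y_ne_negY
  rw [hq, zero_mul, add_zero] at h
  have hgcd : gcd p N ≠ 0 := gcd_ne_zero_of_right hN
  refine ⟨p / gcd p N, N / gcd p N, isCoprime_div_gcd_div_gcd hN,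
    mul_left_cancel₀ ((map_ne_zero_iff _ algebraMap_polynomial_injective).mpr hgcd) ?_⟩
  rw [← map_mul, ← mul_assoc, ← map_mul, EuclideanDomain.mul_div_cancel' hgcd (gcd_dvd_left _ _),
    EuclideanDomain.mul_div_cancel' hgcd (gcd_dvd_right _ _), h]

end FunField

end FunctionField

/-! ### Composition of rational functions -/

section Composition

variable {k : Type*} [Field k]

/-- The value at `u` of the form of degree `m` obtained from `f` by homogenization. -/
noncomputable def homogeneousEval {R : Type*} [CommRing R] [Algebra k R] (f : k[X]) (m : ℕ)
    (u : Fin 2 → R) : R :=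
  ∑ i ∈ Finset.range (m + 1), algebraMap k R (f.coeff i) * (u 0 ^ i * u 1 ^ (m - i))

lemma map_homogeneousEval {R S : Type*} [CommRing R] [CommRing S] [Algebra k R] [Algebra k S]
    (φ : R →ₐ[k] S) (f : k[X]) (m : ℕ) (u : Fin 2 → R) :
    φ (homogeneousEval f m u) = homogeneousEval f m (fun i ↦ φ (u i)) := by
  simp [homogeneousEval]

lemma homogeneousEval_mul {R : Type*} [CommRing R] [Algebra k R] {f : k[X]} {m : ℕ}
    (hf : f.natDegree ≤ m) (z w : R) :
    homogeneousEval f m ![w * z, w] = w ^ m * aeval z f := by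
  rw [aeval_eq_sum_range' (Nat.lt_succ_of_le hf), Finset.mul_sum, homogeneousEval]
  refine Finset.sum_congr rfl fun i hi ↦ ?_
  have : m = (m - i) + i := by grind
  rw [Algebra.smul_def]
  simp only [Matrix.cons_val_zero, Matrix.cons_val_one]
  conv_rhs => rw [this, pow_add]
  ring

lemma homogeneousEval_zero {R : Type*} [CommRing R] [Algebra k R] (f : k[X]) (m : ℕ) (z : R) :
    homogeneousEval f m ![z, 0] = algebraMap k R (f.coeff m) * z ^ m := by
  rw [homogeneousEval, Finset.sum_range_succ, Finset.sum_eq_zero]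
  · simp
  · intro i hi
    have : m - i ≠ 0 := by grind
    simp [this]

lemma HasNoCommonZero.homogeneousEval_ne_zero {w : Fin 2 → k[X]} (hw : HasNoCommonZero w)
    {c : Fin 2 → k} (hc : c ≠ 0) : (fun i ↦ homogeneousEval (w i) (maxDegree w) c) ≠ 0 := by
  by_cases h1 : c 1 = 0
  · have h0 : c 0 ≠ 0 := fun h0 ↦ hc (by ext i; fin_cases i <;> simp [h0, h1])
    have hc' : c = ![c 0, 0] := by ext i; fin_cases i <;> simp [h1]
    obtain ⟨i, hi⟩ := Function.ne_iff.mp (coeff_maxDegree_ne_zero hw.ne_zero)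
    refine Function.ne_iff.mpr ⟨i, ?_⟩
    rw [hc', homogeneousEval_zero]
    exact mul_ne_zero hi (pow_ne_zero _ h0)
  · have hc' : c = ![c 1 * (c 0 / c 1), c 1] := by
      ext i; fin_cases i
      · simp; field_simp
      · simp
    obtain ⟨i, hi⟩ := hw (c 0 / c 1)
    refine Function.ne_iff.mpr ⟨i, ?_⟩
    rw [hc', homogeneousEval_mul (natDegree_le_maxDegree w i), coe_aeval_eq_eval]
    exact mul_ne_zero (pow_ne_zero _ h1) hi

lemma HasNoCommonZero.homogeneousEval {w u : Fin 2 → k[X]} (hw : HasNoCommonZero w)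
    (hu : HasNoCommonZero u) :
    HasNoCommonZero fun i ↦ homogeneousEval (w i) (maxDegree w) u := by
  intro a
  obtain ⟨i, hi⟩ := Function.ne_iff.mp
    (hw.homogeneousEval_ne_zero (c := fun i ↦ (u i).eval a) (Function.ne_iff.mpr (hu a)))
  refine ⟨i, ?_⟩
  rw [← coe_aeval_eq_eval, map_homogeneousEval]
  exact hi

lemma hasTopCoeff_homogeneousEval (f : k[X]) (m : ℕ) {u : Fin 2 → k[X]} {D : ℕ} {a : Fin 2 → k}
    (hu : ∀ i, HasTopCoeff (u i) D (a i)) :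
    HasTopCoeff (homogeneousEval f m u) (m * D) (homogeneousEval f m a) := by
  refine HasTopCoeff.sum _ fun i hi ↦ HasTopCoeff.C_mul _ ?_
  have : m * D = i * D + (m - i) * D := by rw [← add_mul]; congr 1; grind
  rw [this]
  exact ((hu 0).pow i).mul ((hu 1).pow _)

lemma maxDegree_homogeneousEval {w u : Fin 2 → k[X]} (hw : HasNoCommonZero w) (hu : u ≠ 0) :
    maxDegree (fun i ↦ homogeneousEval (w i) (maxDegree w) u) = maxDegree w * maxDegree u :=
  maxDegree_eq_of_hasTopCoeff
    (fun i ↦ hasTopCoeff_homogeneousEval (w i) _ (hasTopCoeff_maxDegree u))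
    (hw.homogeneousEval_ne_zero (coeff_maxDegree_ne_zero hu))

lemma maxDegree_pow {ι : Type*} [Fintype ι] (u : ι → k[X]) (q : ℕ) :
    maxDegree (fun i ↦ u i ^ q) = q * maxDegree u := by
  simp only [maxDegree, natDegree_pow]
  exact (Finset.apply_sup_eq_sup_comp (q * ·) (fun a b ↦ Nat.mul_max_mul_left .. |>.symm) rfl).symm

end Composition

/-! ### Odd points and the Frobenius endomorphism -/

section OddPoints

lemma xRep_map_apply {F K L : Type*} [Field F] {W : WeierstrassCurve F} [Field K] [Field L]
    [Algebra F K] [Algebra F L] [DecidableEq K] [DecidableEq L] (f : K →ₐ[F] L)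
    (P : (W⁄K).toAffine.Point) (i : Fin 2) : (Point.map f P).xRep i = f (P.xRep i) := by
  rcases P with _ | ⟨x, y, h⟩
  · change (![1, 0] : Fin 2 → L) i = f ((![1, 0] : Fin 2 → K) i)
    fin_cases i <;> simp
  · change (![f x, 1] : Fin 2 → L) i = f ((![x, 1] : Fin 2 → K) i)
    fin_cases i <;> simp

lemma hasNoCommonZero_of_isCoprime {k : Type*} [Field k] {f g : k[X]} (h : IsCoprime f g) :
    HasNoCommonZero ![f, g] := by
  obtain ⟨a, b, hab⟩ := h
  intro c
  by_contra! hc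
  have hf : f.eval c = 0 := hc 0
  have hg : g.eval c = 0 := hc 1
  simpa [hf, hg] using congrArg (eval c) hab

lemma transcendental_of_xDegree_ne_zero {F k K : Type*} [Field F] {W : WeierstrassCurve F}
    [Field k] [IsAlgClosed k] [Field K] [Algebra F K] [Algebra k K] [Algebra k[X] K]
    [IsScalarTower k k[X] K] [FaithfulSMul k[X] K] {x y : K}
    {h : (W⁄K).toAffine.Nonsingular x y} (hdeg : xDegree k (.some x y h) ≠ 0) :
    Transcendental k x := by
  intro hx
  obtain ⟨c, rfl⟩ := minpoly.mem_range_of_degree_eq_one k x <|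
    IsAlgClosed.degree_eq_one_of_irreducible k (minpoly.irreducible hx.isIntegral)
  have hc : IsXRep (.some _ y h) ![C c, 1] :=
    ⟨hasNoCommonZero_of_isCoprime isCoprime_one_right, by
      simp [IsScalarTower.algebraMap_apply k k[X] K]⟩
  exact hdeg (by simp [hc.xDegree_eq, maxDegree, Fin.univ_succ])

variable {F : Type*} [Field F] (W : WeierstrassCurve F) (k : Type*) [Field k] [Algebra F k]

/-- The subgroup of the points over the function field that the negation of the curve maps
to their negatives. -/
noncomputable def oddPoints : AddSubgroup (W⁄(FunField W k)).toAffine.Point :=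
  (Point.map (FunField.negHom W k) + AddMonoidHom.id _).ker

variable {W k}

lemma mem_oddPoints {P : (W⁄(FunField W k)).toAffine.Point} :
    P ∈ oddPoints W k ↔ Point.map (FunField.negHom W k) P = -P := by
  rw [oddPoints, AddMonoidHom.mem_ker, AddMonoidHom.add_apply, AddMonoidHom.id_apply,
    add_eq_zero_iff_eq_neg]

variable [W.IsElliptic]

lemma exists_isXRep (P : oddPoints W k) : ∃ u : Fin 2 → k[X], IsXRep P.1 u := by
  obtain ⟨_ | ⟨x, y, h⟩, hP⟩ := P
  · exact ⟨![1, 0], hasNoCommonZero_of_isCoprime isCoprime_one_left, by simp [Point.xRep]⟩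
  · rw [mem_oddPoints, Point.map_some, Point.neg_some, Point.some.injEq] at hP
    obtain ⟨f, g, hfg, h⟩ := FunField.exists_isCoprime_of_negHom_eq hP.1
    exact ⟨![f, g], hasNoCommonZero_of_isCoprime hfg, by simp [Point.xRep, h]⟩

variable (W k) in
lemma nonsingular_x_y :
    (W⁄(FunField W k)).toAffine.Nonsingular (FunField.x W k) (FunField.y W k) :=
  Affine.equation_iff_nonsingular.mp (FunField.equation_x_y W k)

variable (W k) in
/-- The generic point `(x, y)` of the curve. -/
noncomputable def genericPoint : oddPoints W k :=
  ⟨.some _ _ (nonsingular_x_y W k), mem_oddPoints.mpr <| by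
    rw [Point.map_some, Point.neg_some, Point.some.injEq]
    exact ⟨FunField.negHom_x, FunField.negHom_y⟩⟩

variable (W k) in
/-- The degree of the `x`-coordinate on odd points. An odd point is an endomorphism of the curve up
to a translation by a `2`-torsion point, and this is its degree. -/
noncomputable def oddDegree (P : oddPoints W k) : ℤ := xDegree k P.1

omit [W.IsElliptic] in
lemma oddDegree_nonneg (P : oddPoints W k) : 0 ≤ oddDegree W k P := Int.natCast_nonneg _

lemma parallelogramLaw_oddDegree [IsAlgClosed k] : ParallelogramLaw (oddDegree W k) := by
  intro P Q
  obtain ⟨u₁, h₁⟩ := exists_isXRep P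
  obtain ⟨u₂, h₂⟩ := exists_isXRep Q
  obtain ⟨u₃, h₃⟩ := exists_isXRep (P + Q)
  obtain ⟨u₄, h₄⟩ := exists_isXRep (P - Q)
  simp only [oddDegree, h₁.xDegree_eq, h₂.xDegree_eq, h₃.xDegree_eq, h₄.xDegree_eq]
  exact_mod_cast h₁.maxDegree_add h₂ h₃ h₄

lemma isXRep_genericPoint : IsXRep (genericPoint W k).1 (![X, 1] : Fin 2 → k[X]) :=
  ⟨hasNoCommonZero_of_isCoprime isCoprime_one_right, by simp [genericPoint, FunField.x]⟩

lemma oddDegree_genericPoint [IsAlgClosed k] : oddDegree W k (genericPoint W k) = 1 := by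
  rw [oddDegree, isXRep_genericPoint.xDegree_eq]
  simp [maxDegree, Fin.univ_succ]

omit [W.IsElliptic] in
lemma IsXRep.map_evalHom {x y : FunField W k} {h : (W⁄(FunField W k)).toAffine.Nonsingular x y}
    (hx : Transcendental k x) {P : (W⁄(FunField W k)).toAffine.Point} {u w : Fin 2 → k[X]}
    (hP : IsXRep P w) (hu : IsXRep (.some x y h) u) :
    IsXRep (Point.map (FunField.evalHom h.1 hx) P)
      (fun i ↦ homogeneousEval (w i) (maxDegree w) u) := by
  refine ⟨hP.1.homogeneousEval hu.1, ?_⟩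
  have hu' : (fun i ↦ algebraMap k[X] (FunField W k) (u i)) =
      ![algebraMap k[X] (FunField W k) (u 1) * x, algebraMap k[X] (FunField W k) (u 1)] := by
    ext i; fin_cases i
    · exact (mul_one _).symm.trans hu.2
    · rfl
  have hcomp (i) : algebraMap k[X] (FunField W k) (homogeneousEval (w i) (maxDegree w) u) =
      algebraMap k[X] (FunField W k) (u 1) ^ maxDegree w * aeval x (w i) := by
    rw [← homogeneousEval_mul (natDegree_le_maxDegree w i), ← hu']
    exact map_homogeneousEval (IsScalarTower.toAlgHom k k[X] (FunField W k)) _ _ _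
  rw [hcomp, hcomp, xRep_map_apply, xRep_map_apply, ← FunField.evalHom_algebraMap h.1 hx,
    ← FunField.evalHom_algebraMap h.1 hx, mul_assoc, mul_assoc, ← map_mul, ← map_mul, hP.2]

-- `f` is composition with the endomorphism that `α` represents.
lemma exists_algHom_oddDegree_mul [IsAlgClosed k] {α : oddPoints W k}
    (hα : oddDegree W k α ≠ 0) :
    ∃ f : FunField W k →ₐ[F] FunField W k, Point.map f (genericPoint W k).1 = α.1 ∧
      ∀ P Q : oddPoints W k, Point.map f P.1 = Q.1 →
        oddDegree W k Q = oddDegree W k P * oddDegree W k α := by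
  obtain ⟨u, hu⟩ := exists_isXRep α
  obtain ⟨_ | ⟨x, y, h⟩, hαodd⟩ := α
  · exact absurd (parallelogramLaw_oddDegree (W := W) (k := k)).map_zero hα
  · have hx : Transcendental k x := transcendental_of_xDegree_ne_zero fun h0 ↦ hα <| by
      rw [oddDegree, h0, Nat.cast_zero]
    refine ⟨FunField.evalHom h.1 hx, ?_, fun P Q hPQ ↦ ?_⟩
    · rw [genericPoint, Point.map_some, Point.some.injEq]
      exact ⟨FunField.evalHom_x _ _, FunField.evalHom_y _ _⟩
    · obtain ⟨w, hw⟩ := exists_isXRep P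
      rw [oddDegree, oddDegree, oddDegree, ← hPQ, (hw.map_evalHom hx hu).xDegree_eq,
        hw.xDegree_eq, hu.xDegree_eq, maxDegree_homogeneousEval hw.1 hu.1.ne_zero, Nat.cast_mul]

end OddPoints

section Frobenius

variable {F : Type*} [Field F] [Fintype F] (W : WeierstrassCurve F)
  (k : Type*) [Field k] [Algebra F k]

/-- The Frobenius endomorphism of the odd points over the function field. -/
noncomputable def frobeniusHom : oddPoints W k →+ oddPoints W k :=
  ((Point.map (FiniteField.frobeniusAlgHom F (FunField W k))).comp
    (oddPoints W k).subtype).codRestrict _ fun P ↦ by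
      rw [mem_oddPoints, AddMonoidHom.comp_apply, AddSubgroup.subtype_apply, ← map_neg,
        ← mem_oddPoints.mp P.2, Point.map_map, Point.map_map]
      congr 2
      ext z
      exact map_pow (FunField.negHom W k) z _

variable {W k}

lemma coe_frobeniusHom (P : oddPoints W k) : (frobeniusHom W k P).1 =
    Point.map (FiniteField.frobeniusAlgHom F (FunField W k)) P.1 :=
  rfl

lemma map_coe_frobeniusHom (f : FunField W k →ₐ[F] FunField W k) {P Q : oddPoints W k}
    (h : Point.map f P.1 = Q.1) :
    Point.map f (frobeniusHom W k P).1 = (frobeniusHom W k Q).1 := by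
  rw [coe_frobeniusHom, coe_frobeniusHom, ← h, Point.map_map, Point.map_map]
  congr 2
  ext z
  exact map_pow f z _

variable [W.IsElliptic] [IsAlgClosed k]

lemma oddDegree_frobeniusHom (P : oddPoints W k) :
    oddDegree W k (frobeniusHom W k P) = Fintype.card F * oddDegree W k P := by
  obtain ⟨u, h⟩ := exists_isXRep P
  have h' : IsXRep (frobeniusHom W k P).1 fun i ↦ u i ^ Fintype.card F := by
    refine ⟨fun a ↦ ?_, ?_⟩
    · obtain ⟨i, hi⟩ := h.1 a
      exact ⟨i, by rw [eval_pow]; exact pow_ne_zero _ hi⟩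
    · rw [coe_frobeniusHom, xRep_map_apply, xRep_map_apply, FiniteField.coe_frobeniusAlgHom,
        map_pow, map_pow, ← mul_pow, ← mul_pow, h.2]
  rw [oddDegree, oddDegree, h.xDegree_eq, h'.xDegree_eq, maxDegree_pow, Nat.cast_mul]

-- `φ² - 1` is the composite of `φ - 1` and `φ + 1`.
lemma oddDegree_frobeniusHom_frobeniusHom_sub :
    oddDegree W k (frobeniusHom W k (frobeniusHom W k (genericPoint W k)) - genericPoint W k) =
      oddDegree W k (frobeniusHom W k (genericPoint W k) - genericPoint W k) *
        oddDegree W k (frobeniusHom W k (genericPoint W k) + genericPoint W k) := by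
  set φ := frobeniusHom W k
  set e := genericPoint W k
  set α := φ e + e with hα
  have hdeg := parallelogramLaw_oddDegree (W := W) (k := k)
  rw [show φ (φ e) - e = φ α - α by rw [hα, map_add]; abel]
  by_cases h0 : oddDegree W k α = 0
  · have h1 : oddDegree W k (φ α) = 0 := by rw [oddDegree_frobeniusHom, h0, mul_zero]
    rw [hdeg.map_sub, hdeg.polarHom_eq_zero oddDegree_nonneg h1, h0, h1]
    ring
  · obtain ⟨f, hfe, hf⟩ := exists_algHom_oddDegree_mul h0
    refine hf _ _ ?_
    rw [AddSubgroup.coe_sub, AddSubgroup.coe_sub, map_sub, map_coe_frobeniusHom f hfe, hfe]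

end Frobenius

/-! ### Points fixed by a power of Frobenius -/

section FrobeniusSub

lemma pow_natCard_eq_self_iff {L k : Type*} [Field L] [Finite L] [Field k] (ι : L →+* k) {a : k} :
    a ^ Nat.card L = a ↔ a ∈ Set.range ι := by
  have := Fintype.ofFinite L
  have hL : 1 < Fintype.card L := Fintype.one_lt_card
  have hroots : (X ^ Fintype.card L - X : k[X]).roots = Finset.univ.val.map ι := by
    rw [← FiniteField.roots_X_pow_card_sub_X L,
      roots_map_of_injective_of_card_eq_natDegree ι.injective]
    · simp only [Polynomial.map_sub, Polynomial.map_pow, map_X]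
    · rw [FiniteField.roots_X_pow_card_sub_X, FiniteField.X_pow_card_sub_X_natDegree_eq L hL,
        Finset.card_val, Finset.card_univ]
  have hmem : a ∈ (X ^ Fintype.card L - X : k[X]).roots ↔ a ^ Fintype.card L = a := by
    rw [mem_roots (FiniteField.X_pow_card_sub_X_ne_zero k hL), IsRoot.def, eval_sub, eval_pow,
      eval_X, sub_eq_zero]
  rw [Nat.card_eq_fintype_card, ← hmem, hroots]
  simp

lemma rootMultiplicity_X_pow_sub_X {k : Type*} [Field k] {p Q : ℕ} [CharP k p] (hp : p ∣ Q)
    (hQ : 1 < Q) {a : k} (ha : a ^ Q = a) : rootMultiplicity a (X ^ Q - X : k[X]) = 1 := by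
  classical
  rw [← count_roots]
  refine Multiset.count_eq_one_of_mem (nodup_roots (galois_poly_separable p Q hp)) ?_
  rw [mem_roots (FiniteField.X_pow_card_sub_X_ne_zero k hQ)]
  simp [ha]

lemma symSq_eq_zero {k : Type*} [Field k] {u v : Fin 2 → k} (hu : u ≠ 0) (hv : v ≠ 0)
    (h1 : symSq u v 1 = 0) (h2 : symSq u v 2 = 0) : u 1 = 0 ∧ v 1 = 0 := by
  have h1' : u 0 * v 1 + u 1 * v 0 = 0 := h1
  have h2' : u 1 * v 1 = 0 := h2
  have hu' : u 0 ≠ 0 ∨ u 1 ≠ 0 := by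
    by_contra! h
    exact hu (by ext i; fin_cases i <;> simp [h])
  have hv' : v 0 ≠ 0 ∨ v 1 ≠ 0 := by
    by_contra! h
    exact hv (by ext i; fin_cases i <;> simp [h])
  grind

lemma hasTopCoeff_X_pow_one (R : Type*) [CommRing R] {Q : ℕ} (hQ : Q ≠ 0) (i : Fin 2) :
    HasTopCoeff ((![X ^ Q, 1] : Fin 2 → R[X]) i) Q ((![1, 0] : Fin 2 → R) i) := by
  fin_cases i
  · exact ⟨natDegree_X_pow_le Q, by simp⟩
  · exact ⟨by simp, by simp [coeff_one, hQ]⟩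

lemma natDegree_lt_maxDegree {ι k : Type*} [Fintype ι] [Field k] {u : ι → k[X]} {i : ι}
    (hi : u i ≠ 0) (h : (u i).coeff (maxDegree u) = 0) : (u i).natDegree < maxDegree u := by
  refine (natDegree_le_maxDegree u i).lt_of_ne fun hd ↦ hi ?_
  rwa [← hd, coeff_natDegree, leadingCoeff_eq_zero] at h

lemma exists_equation {F k : Type*} [Field F] [Field k] [Algebra F k] [IsAlgClosed k]
    (W : WeierstrassCurve F) (a : k) : ∃ b : k, (W⁄k).toAffine.Equation a b := by
  obtain ⟨b, hb⟩ := IsAlgClosed.exists_root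
    (C 1 * X ^ 2 + C (algebraMap F k W.a₁ * a + algebraMap F k W.a₃) * X +
      C (-(a ^ 3 + algebraMap F k W.a₂ * a ^ 2 + algebraMap F k W.a₄ * a +
        algebraMap F k W.a₆))) (by rw [degree_quadratic one_ne_zero]; decide)
  refine ⟨b, (equation_baseChange_iff W a b).mpr ?_⟩
  simp only [IsRoot.def, eval_add, eval_mul, eval_C, eval_pow, eval_X] at hb
  linear_combination hb

section Ordinates

variable {F : Type*} [Field F] [Fintype F] {W : WeierstrassCurve F} {k : Type*} [Field k]
  [Algebra F k]

lemma frobeniusAlgHom_pow_apply {R : Type*} [CommRing R] [Algebra F R] (n : ℕ) (z : R) :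
    (FiniteField.frobeniusAlgHom F R ^ n) z = z ^ Fintype.card F ^ n := by
  rw [AlgHom.coe_pow, FiniteField.coe_frobeniusAlgHom, pow_iterate]

lemma pow_eq_or_pow_eq_negY {n : ℕ} {a b : k} (hab : (W⁄k).toAffine.Equation a b)
    (ha : a ^ Fintype.card F ^ n = a) :
    b ^ Fintype.card F ^ n = b ∨ b ^ Fintype.card F ^ n = (W⁄k).toAffine.negY a b := by
  have h := (Affine.baseChange_equation (W := W)
    (FiniteField.frobeniusAlgHom F k ^ n).injective a b).mpr hab
  rw [frobeniusAlgHom_pow_apply, frobeniusAlgHom_pow_apply, ha] at h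
  exact Affine.Y_eq_of_X_eq h hab rfl

lemma negY_pow {n : ℕ} {a : k} (b : k) (ha : a ^ Fintype.card F ^ n = a) :
    (W⁄k).toAffine.negY a b ^ Fintype.card F ^ n =
      (W⁄k).toAffine.negY a (b ^ Fintype.card F ^ n) := by
  have h := Affine.baseChange_negY (W' := W) (FiniteField.frobeniusAlgHom F k ^ n) a b
  rwa [frobeniusAlgHom_pow_apply, frobeniusAlgHom_pow_apply, frobeniusAlgHom_pow_apply, ha,
    eq_comm] at h

open scoped Classical in
lemma ncard_ordinates {n : ℕ} {a b : k} (hab : (W⁄k).toAffine.Equation a b)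
    (ha : a ^ Fintype.card F ^ n = a) :
    {z | z ^ Fintype.card F ^ n = z ∧ (W⁄k).toAffine.Equation a z}.ncard =
      if b = (W⁄k).toAffine.negY a b then 1 else
        if b ^ Fintype.card F ^ n = b then 2 else 0 := by
  have hmem (z : k) : (W⁄k).toAffine.Equation a z ↔ z = b ∨ z = (W⁄k).toAffine.negY a b := by
    refine ⟨fun h ↦ Affine.Y_eq_of_X_eq h hab rfl, ?_⟩
    rintro (rfl | rfl)
    exacts [hab, (Affine.equation_neg _ _).mpr hab]
  have hb := pow_eq_or_pow_eq_negY hab ha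
  have hb' := negY_pow (W := W) b ha
  simp only [hmem]
  split_ifs with h1 h2
  · rw [← h1, or_self] at hb
    refine Set.ncard_eq_one.mpr ⟨b, Set.ext fun z ↦ ?_⟩
    rw [Set.mem_ofPred_eq, ← h1, or_self, Set.mem_singleton_iff]
    exact and_iff_right_of_imp fun hz ↦ hz ▸ hb
  · refine Set.ncard_eq_two.mpr ⟨b, _, h1, Set.ext fun z ↦ and_iff_right_of_imp ?_⟩
    rintro (rfl | rfl)
    exacts [h2, by rw [hb', h2]]
  · rw [hb.resolve_left h2, Affine.negY_negY] at hb'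
    refine (congrArg Set.ncard (Set.eq_empty_of_forall_notMem ?_)).trans (Set.ncard_empty _)
    rintro z ⟨hz, rfl | rfl⟩
    exacts [h2 hz, h1 (hb'.symm.trans hz)]

end Ordinates

section AddSubFrobenius

variable {F : Type*} [Field F] {W : WeierstrassCurve F} {k : Type*} [Field k] [Algebra F k]
  {Q : ℕ} {c : k} {u v : Fin 2 → k[X]}

lemma X_pow_sub_X_sq_eq
    (h : addSubVec ((W⁄k).map C) (symSq ![X ^ Q, 1] ![X, 1]) = fun i ↦ C c * symSq u v i) :
    (X ^ Q - X) ^ 2 = C c * (u 1 * v 1) := by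
  refine Eq.trans ?_ (congrFun h 2)
  simp only [addSubVec_eq, symSq, Matrix.cons_val_zero, Matrix.cons_val_one, Matrix.cons_val]
  ring

lemma eval_symSq_one_eq
    (h : addSubVec ((W⁄k).map C) (symSq ![X ^ Q, 1] ![X, 1]) = fun i ↦ C c * symSq u v i)
    {a b : k} (hab : (W⁄k).toAffine.Equation a b) (ha : a ^ Q = a) :
    c * ((u 0).eval a * (v 1).eval a + (u 1).eval a * (v 0).eval a) =
      (b - (W⁄k).toAffine.negY a b) ^ 2 := by
  have h1 := congrArg (eval a) (congrFun h 1)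
  rw [equation_baseChange_iff] at hab
  simp only [symSq, Matrix.cons_val_zero, Matrix.cons_val_one, Matrix.cons_val_fin_one, mul_one,
    one_mul, addSubVec_eq, b₂, b₄, b₆, map_a₁, map_a₂, map_a₃, map_a₄, map_a₆, Matrix.cons_val,
    Affine.baseChange_a₁, Affine.baseChange_a₂, Affine.baseChange_a₃, Affine.baseChange_a₄,
    Affine.baseChange_a₆, eval_add, eval_mul, eval_ofNat, eval_pow, eval_X, eval_C, one_pow,
    ha] at h1
  rw [negY_baseChange]
  linear_combination (-4) * hab - h1

lemma rootMultiplicity_add_rootMultiplicity {p : ℕ} [CharP k p] (hp : p ∣ Q) (hQ : 1 < Q)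
    (h : (X ^ Q - X) ^ 2 = C c * (u 1 * v 1)) {a : k} (ha : a ^ Q = a) :
    rootMultiplicity a (u 1) + rootMultiplicity a (v 1) = 2 := by
  have hX := FiniteField.X_pow_card_sub_X_ne_zero k hQ
  have hne : C c * (u 1 * v 1) ≠ 0 := h ▸ pow_ne_zero 2 hX
  rw [← zero_add (rootMultiplicity a (u 1) + _), ← rootMultiplicity_C c a,
    ← rootMultiplicity_mul (right_ne_zero_of_mul hne), ← rootMultiplicity_mul hne, ← h, sq,
    rootMultiplicity_mul (mul_self_ne_zero.mpr hX), rootMultiplicity_X_pow_sub_X hp hQ ha]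

lemma hasTopCoeff_addSubVec_X_pow (hQ : Q ≠ 0) (i : Fin 3) :
    HasTopCoeff (addSubVec ((W⁄k).map C) (symSq ![X ^ Q, 1] ![X, 1]) i) (2 * (Q + 1))
      ((![1, 0, 0] : Fin 3 → k) i) := by
  have hX : addSubVec (W⁄k) (symSq ![1, 0] ![1, 0]) = ![1, 0, 0] := by
    simp [addSubVec_eq, symSq]
  rw [← hX]
  exact hasTopCoeff_addSubVec (W⁄k) (hasTopCoeff_symSq (hasTopCoeff_X_pow_one k hQ)
    (pow_one (X : k[X]) ▸ hasTopCoeff_X_pow_one k one_ne_zero)) i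

-- The top coefficients of `u` and `v` are those of the point at infinity, so both degrees are
-- attained by the first entries only; as they add up to `2 (Q + 1)` while the degrees of the second
-- entries add up to `2 Q`, the difference is one for both.
lemma maxDegree_eq_natDegree_add_one (hQ : 1 < Q) (hc : c ≠ 0) (hu : u ≠ 0) (hv : v ≠ 0)
    (h : addSubVec ((W⁄k).map C) (symSq ![X ^ Q, 1] ![X, 1]) = fun i ↦ C c * symSq u v i) :
    maxDegree v = (v 1).natDegree + 1 := by
  have hsq := X_pow_sub_X_sq_eq h
  have htop := hasTopCoeff_addSubVec_X_pow (W := W) (k := k) (Nat.ne_zero_of_lt hQ)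
  have hdeg : maxDegree u + maxDegree v = 2 * (Q + 1) := by
    rw [← maxDegree_symSq hu hv, ← maxDegree_C_mul _ hc, ← h]
    exact maxDegree_eq_of_hasTopCoeff htop (Function.ne_iff.mpr ⟨0, one_ne_zero⟩)
  have hcoeff (i : Fin 3) : c * symSq (fun j ↦ (u j).coeff (maxDegree u))
      (fun j ↦ (v j).coeff (maxDegree v)) i = (![1, 0, 0] : Fin 3 → k) i := by
    rw [← (htop i).2, h, ← hdeg]
    exact ((hasTopCoeff_symSq (hasTopCoeff_maxDegree u) (hasTopCoeff_maxDegree v) i).C_mul c).2.symm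
  obtain ⟨hu1, hv1⟩ := symSq_eq_zero (coeff_maxDegree_ne_zero hu) (coeff_maxDegree_ne_zero hv)
    ((mul_eq_zero_iff_left hc).mp (hcoeff 1)) ((mul_eq_zero_iff_left hc).mp (hcoeff 2))
  have hne : C c * (u 1 * v 1) ≠ 0 :=
    hsq ▸ pow_ne_zero 2 (FiniteField.X_pow_card_sub_X_ne_zero k hQ)
  obtain ⟨hu', hv'⟩ := mul_ne_zero_iff.mp (right_ne_zero_of_mul hne)
  have hu_lt := natDegree_lt_maxDegree hu' hu1
  have hv_lt := natDegree_lt_maxDegree hv' hv1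
  have hnat : 2 * Q = (u 1).natDegree + (v 1).natDegree := by
    rw [← natDegree_mul hu' hv', ← natDegree_C_mul hc, ← hsq, natDegree_pow,
      FiniteField.X_pow_card_sub_X_natDegree_eq k hQ]
  lia

end AddSubFrobenius

end FrobeniusSub

section FrobeniusAdd

variable {F : Type*} [Field F] {W : WeierstrassCurve F} {k : Type*} [Field k] [Algebra F k] {Q : ℕ}

lemma FunField.x_pow_ne_x (hQ : 1 < Q) : x W k ^ Q ≠ x W k := by
  rw [x, ← map_pow]
  exact fun h ↦ FiniteField.X_pow_card_sub_X_ne_zero k hQ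
    (sub_eq_zero.mpr (algebraMap_polynomial_injective h))

variable [W.IsElliptic]
  {h : (W⁄(FunField W k)).toAffine.Nonsingular (FunField.x W k ^ Q) (FunField.y W k ^ Q)}
  {u : Fin 2 → k[X]}

-- The formula for the slope, with the denominators cleared.
lemma IsXRep.algebraMap_mul_eq (hQ : 1 < Q)
    (hu : IsXRep (.some _ _ h + (genericPoint W k).1) u) :
    letI y := Affine.CoordinateRing.mk (W⁄k).toAffine Y
    algebraMap k[X] (W⁄k).toAffine.CoordinateRing (u 0 * (X ^ Q - X) ^ 2) =
      algebraMap k[X] _ (u 1) * ((y ^ Q - y) ^ 2 +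
        algebraMap k[X] _ (C (algebraMap F k W.a₁) * (X ^ Q - X)) * (y ^ Q - y) -
        algebraMap k[X] _ ((C (algebraMap F k W.a₂) + X ^ Q + X) * (X ^ Q - X) ^ 2)) := by
  apply FunField.algebraMap_coordinateRing_injective
  have hne : FunField.x W k ^ Q ≠ FunField.x W k := FunField.x_pow_ne_x hQ
  rw [genericPoint, Point.add_of_X_ne hne] at hu
  have hu' : algebraMap k[X] (FunField W k) (u 0) * 1 = algebraMap k[X] (FunField W k) (u 1) *
      (W⁄(FunField W k)).toAffine.addX _ _ ((W⁄(FunField W k)).toAffine.slope _ _ _ _) := hu.2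
  rw [mul_one, Affine.addX, Affine.slope_of_X_ne hne, Affine.baseChange_a₁, Affine.baseChange_a₂,
    FunField.algebraMap_eq_algebraMap_C, FunField.algebraMap_eq_algebraMap_C] at hu'
  have hne' := sub_ne_zero.mpr hne
  have hX : algebraMap k[X] (FunField W k) X = FunField.x W k := rfl
  have hY : algebraMap _ (FunField W k) (Affine.CoordinateRing.mk (W⁄k).toAffine Y) =
    FunField.y W k := rfl
  simp only [map_mul, map_sub, map_add, map_pow, ← IsScalarTower.algebraMap_apply, hX, hY, hu']
  field_simp
  ring

lemma IsXRep.eval_mul_eval_eq (hQ : 1 < Q)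
    (hu : IsXRep (.some _ _ h + (genericPoint W k).1) u)
    {c : k} {v : k[X]} (hv : (X ^ Q - X) ^ 2 = C c * (u 1 * v))
    {a b : k} (hab : (W⁄k).toAffine.Equation a b) (ha : a ^ Q = a) :
    c * ((u 0).eval a * v.eval a) = (b ^ Q - b) ^ 2 := by
  have hu1 : u 1 ≠ 0 := fun h0 ↦ pow_ne_zero 2 (FiniteField.X_pow_card_sub_X_ne_zero k hQ) <| by
    rw [hv, h0, zero_mul, mul_zero]
  have hring := hu.algebraMap_mul_eq hQ
  rw [hv, show u 0 * (C c * (u 1 * v)) = u 1 * (C c * (u 0 * v)) by ring, map_mul, ← hv] at hring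
  have hk := congrArg (FunField.evalRing hab) <| mul_left_cancel₀
    ((map_ne_zero_iff _ (FaithfulSMul.algebraMap_injective _ _)).mpr hu1) hring
  rw [map_sub _ (_ + _), map_add, map_mul _ (algebraMap k[X] _ _), map_pow, map_sub _ (_ ^ Q),
    map_pow] at hk
  simp only [FunField.evalRing_algebraMap, FunField.evalRing_mk_Y, map_mul, map_sub, map_pow,
    aeval_C, aeval_X, ha, coe_aeval_eq_eval] at hk
  simpa using hk

end FrobeniusAdd

section FixedPoints

lemma natCard_point_eq_add_one {F : Type*} [Field F] {W : WeierstrassCurve F} [W.IsElliptic]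
    {L : Type*} [Field L] [Fintype L] [Algebra F L] :
    Nat.card (W⁄L).toAffine.Point =
      ∑ z : L, {w | (W⁄L).toAffine.Equation z w}.ncard + 1 := by
  rw [Nat.card_congr (Affine.pointEquiv (W⁄L).toAffine)]
  refine Finite.card_option.trans ?_
  rw [Nat.card_congr (Equiv.subtypeProdEquivSigmaSubtype _), Nat.card_sigma]
  rfl

variable {F : Type*} [Field F] [Fintype F] {W : WeierstrassCurve F} [W.IsElliptic]
  {k : Type*} [Field k] [Algebra F k]

lemma exists_coe_frobeniusHom_iterate_genericPoint (n : ℕ) :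
    ∃ h, ((frobeniusHom W k)^[n] (genericPoint W k)).1 =
      .some (FunField.x W k ^ Fintype.card F ^ n) (FunField.y W k ^ Fintype.card F ^ n) h := by
  induction n with
  | zero =>
    simp only [pow_zero, pow_one]
    exact ⟨nonsingular_x_y W k, rfl⟩
  | succ n ih =>
    obtain ⟨h, hn⟩ := ih
    simp only [Function.iterate_succ_apply', coe_frobeniusHom, hn, pow_succ, pow_mul]
    exact ⟨(Affine.baseChange_nonsingular _
      (FiniteField.frobeniusAlgHom F (FunField W k)).injective _ _).mpr h, rfl⟩

lemma isXRep_frobeniusHom_iterate (n : ℕ) : IsXRep ((frobeniusHom W k)^[n] (genericPoint W k)).1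
    (![X ^ Fintype.card F ^ n, 1] : Fin 2 → k[X]) := by
  obtain ⟨h, hn⟩ := exists_coe_frobeniusHom_iterate_genericPoint (W := W) (k := k) n
  rw [hn]
  exact ⟨hasNoCommonZero_of_isCoprime isCoprime_one_right, by simp [FunField.x]⟩

variable [IsAlgClosed k] {n : ℕ} {u v : Fin 2 → k[X]}

section

variable (hu : IsXRep ((frobeniusHom W k)^[n] (genericPoint W k) + genericPoint W k).1 u)
  (hv : IsXRep ((frobeniusHom W k)^[n] (genericPoint W k) - genericPoint W k).1 v)
include hu hv

lemma exists_addSubVec_frobeniusHom_eq : ∃ c : k, c ≠ 0 ∧ addSubVec ((W⁄k).map C)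
    (symSq ![X ^ Fintype.card F ^ n, 1] ![X, 1]) = fun i ↦ C c * symSq u v i :=
  (isXRep_frobeniusHom_iterate n).exists_addSubVec_eq isXRep_genericPoint hu hv

-- Evaluating the addition-subtraction formula at a point `(a, b)`: its last entries and the value
-- of `u 0 * v 1` tell which of `u 1`, `v 1` vanish at `a`, in terms of the action of `φⁿ` on
-- `(a, b)`.
lemma rootMultiplicity_eq_ncard (hn : n ≠ 0) {a : k} (ha : a ^ Fintype.card F ^ n = a) :
    rootMultiplicity a (v 1) =
      {b | b ^ Fintype.card F ^ n = b ∧ (W⁄k).toAffine.Equation a b}.ncard := by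
  have hQ : 1 < Fintype.card F ^ n := Nat.one_lt_pow hn Fintype.one_lt_card
  obtain ⟨c, hc, huv⟩ := exists_addSubVec_frobeniusHom_eq hu hv
  obtain ⟨b, hab⟩ := exists_equation W a
  have hsq := X_pow_sub_X_sq_eq huv
  have h1 := eval_symSq_one_eq huv hab ha
  have h01 : c * ((u 0).eval a * (v 1).eval a) = (b ^ Fintype.card F ^ n - b) ^ 2 := by
    obtain ⟨h, hφ⟩ := exists_coe_frobeniusHom_iterate_genericPoint (W := W) (k := k) n
    rw [AddSubgroup.coe_add, hφ] at hu
    exact hu.eval_mul_eval_eq hQ hsq hab ha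
  have hadd : rootMultiplicity a (u 1) + rootMultiplicity a (v 1) = 2 := by
    obtain ⟨p, _, m, -, hm⟩ := FiniteField.card' F
    have : CharP k p := charP_of_injective_algebraMap' F p
    exact rootMultiplicity_add_rootMultiplicity
      (hm ▸ dvd_pow (dvd_pow_self p m.ne_zero) hn) hQ hsq ha
  have hne : u 1 * v 1 ≠ 0 := right_ne_zero_of_mul <|
    hsq ▸ pow_ne_zero 2 (FiniteField.X_pow_card_sub_X_ne_zero k hQ)
  rw [ncard_ordinates hab ha]
  split_ifs with h2 h3
  · rw [sub_eq_zero.mpr h2, zero_pow two_ne_zero, mul_eq_zero_iff_left hc] at h1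
    have h11 : (u 1).eval a * (v 1).eval a = 0 := by
      simpa [ha, hc] using (congrArg (eval a) hsq).symm
    obtain ⟨hu1, hv1⟩ := symSq_eq_zero (u := fun i ↦ (u i).eval a) (v := fun i ↦ (v i).eval a)
      (Function.ne_iff.mpr (hu.1 a)) (Function.ne_iff.mpr (hv.1 a)) h1 h11
    have hu_pos := (rootMultiplicity_pos (left_ne_zero_of_mul hne)).mpr hu1
    have hv_pos := (rootMultiplicity_pos (right_ne_zero_of_mul hne)).mpr hv1
    lia
  · have hu1 : (u 1).eval a ≠ 0 := fun h0 ↦ h2 <| by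
      rw [h0, zero_mul, add_zero, h01, h3, sub_self, zero_pow two_ne_zero, eq_comm] at h1
      exact sub_eq_zero.mp (pow_eq_zero_iff two_ne_zero |>.mp h1)
    rwa [rootMultiplicity_eq_zero hu1, zero_add] at hadd
  · refine rootMultiplicity_eq_zero fun h0 ↦ h3 ?_
    rw [h0, mul_zero, mul_zero, eq_comm] at h01
    exact sub_eq_zero.mp (pow_eq_zero_iff two_ne_zero |>.mp h01)

lemma natDegree_eq_sum_ncard (hn : n ≠ 0) {L : Type*} [Field L] [Fintype L] (ι : L →+* k)
    (hL : Nat.card L = Fintype.card F ^ n) : (v 1).natDegree =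
      ∑ z : L, {b | b ^ Fintype.card F ^ n = b ∧ (W⁄k).toAffine.Equation (ι z) b}.ncard := by
  classical
  have hfix (a : k) : a ^ Fintype.card F ^ n = a ↔ a ∈ Set.range ι :=
    hL ▸ pow_natCard_eq_self_iff ι
  obtain ⟨_, -, huv⟩ := exists_addSubVec_frobeniusHom_eq hu hv
  have hroots (a : k) (ha : a ∈ (v 1).roots) : a ∈ Finset.univ.image ι := by
    have h := congrArg (eval a) (X_pow_sub_X_sq_eq huv)
    rw [eval_mul, eval_mul, (isRoot_of_mem_roots ha).eq_zero, mul_zero, mul_zero, eval_pow,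
      pow_eq_zero_iff two_ne_zero, eval_sub, eval_pow, eval_X, sub_eq_zero, hfix] at h
    simpa using h
  rw [← IsAlgClosed.card_roots_eq_natDegree, ← Multiset.sum_count_eq_card hroots,
    Finset.sum_image ι.injective.injOn]
  refine Finset.sum_congr rfl fun z _ ↦ ?_
  rw [count_roots, rootMultiplicity_eq_ncard hu hv hn ((hfix _).mpr ⟨z, rfl⟩)]

end

lemma oddDegree_frobeniusHom_iterate_sub (hn : n ≠ 0) {L : Type*} [Field L] [Finite L]
    [Algebra F L] (ι : L →ₐ[F] k) (hL : Nat.card L = Fintype.card F ^ n) :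
    oddDegree W k ((frobeniusHom W k)^[n] (genericPoint W k) - genericPoint W k) =
      Nat.card (W⁄L).toAffine.Point := by
  have := Fintype.ofFinite L
  obtain ⟨u, hu⟩ := exists_isXRep ((frobeniusHom W k)^[n] (genericPoint W k) + genericPoint W k)
  obtain ⟨v, hv⟩ := exists_isXRep ((frobeniusHom W k)^[n] (genericPoint W k) - genericPoint W k)
  obtain ⟨c, hc, huv⟩ := exists_addSubVec_frobeniusHom_eq hu hv
  rw [oddDegree, hv.xDegree_eq, natCard_point_eq_add_one, maxDegree_eq_natDegree_add_one
    (Nat.one_lt_pow hn Fintype.one_lt_card) hc hu.1.ne_zero hv.1.ne_zero huv,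
    natDegree_eq_sum_ncard hu hv hn ι.toRingHom hL]
  congr 2
  refine Finset.sum_congr rfl fun z _ ↦ ?_
  rw [← Set.ncard_image_of_injective _ ι.injective]
  congr 1
  ext b
  rw [← hL, Set.mem_ofPred_eq, pow_natCard_eq_self_iff ι.toRingHom]
  refine ⟨?_, ?_⟩
  · rintro ⟨⟨w, rfl⟩, h⟩
    exact ⟨w, (Affine.baseChange_equation (W := W) (f := ι) ι.injective z w).mp h, rfl⟩
  · rintro ⟨w, h, rfl⟩
    exact ⟨⟨w, rfl⟩, (Affine.baseChange_equation (W := W) (f := ι) ι.injective z w).mpr h⟩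

end FixedPoints

/-! ### Traces of Frobenius -/

section Trace

variable {F : Type*} [Field F] [Fintype F] (W : WeierstrassCurve F) [W.IsElliptic]
  (k : Type*) [Field k] [IsAlgClosed k] [Algebra F k]

/-- The trace of the `n`-th power of the Frobenius endomorphism `φ`, that is,
`deg (φⁿ + 1) - deg φⁿ - 1`. -/
noncomputable def frobeniusPowTrace (n : ℕ) : ℤ :=
  (parallelogramLaw_oddDegree (W := W) (k := k)).polarHom (genericPoint W k)
    ((frobeniusHom W k)^[n] (genericPoint W k))

lemma frobeniusPowTrace_zero : frobeniusPowTrace W k 0 = 2 := by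
  rw [frobeniusPowTrace, Function.iterate_zero_apply, ParallelogramLaw.polarHom_self,
    oddDegree_genericPoint, mul_one]

lemma frobeniusPowTrace_add_two (n : ℕ) : frobeniusPowTrace W k (n + 2) =
    frobeniusPowTrace W k 1 * frobeniusPowTrace W k (n + 1) -
      Fintype.card F * frobeniusPowTrace W k n :=
  parallelogramLaw_oddDegree.polarHom_recurrence oddDegree_nonneg oddDegree_frobeniusHom
    oddDegree_genericPoint oddDegree_frobeniusHom_frobeniusHom_sub n

lemma sq_frobeniusPowTrace_one_le : frobeniusPowTrace W k 1 ^ 2 ≤ 4 * Fintype.card F :=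
  parallelogramLaw_oddDegree.sq_polarHom_le oddDegree_nonneg oddDegree_frobeniusHom
    oddDegree_genericPoint

lemma natCard_point_eq (L : Type*) [Field L] [Algebra F L] [FiniteDimensional F L] :
    (Nat.card (W⁄L).toAffine.Point : ℤ) = (Fintype.card F : ℤ) ^ Module.finrank F L + 1 -
      frobeniusPowTrace W k (Module.finrank F L) := by
  have : Finite L := Module.finite_of_finite F
  have hL : Nat.card L = Fintype.card F ^ Module.finrank F L := by
    rw [Module.natCard_eq_pow_finrank (K := F), Nat.card_eq_fintype_card]
  rw [← oddDegree_frobeniusHom_iterate_sub (Module.finrank_pos (R := F) (M := L)).ne'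
    (IsAlgClosed.lift : L →ₐ[F] k) hL]
  exact parallelogramLaw_oddDegree.map_iterate_sub oddDegree_frobeniusHom oddDegree_genericPoint _

end Trace

section Torsion

open scoped Classical in
lemma exists_intermediateField_dvd_natCard_point {F k : Type*} [Field F] [Finite F] [Field k]
    [Algebra F k] [Algebra.IsAlgebraic F k] {W : WeierstrassCurve F} {p : ℕ} [Fact p.Prime]
    {P : (W⁄k).toAffine.Point} (hP : P ≠ 0) (hpP : p • P = 0) :
    ∃ K : IntermediateField F k, FiniteDimensional F K ∧
      p ∣ Nat.card (W⁄K).toAffine.Point := by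
  obtain _ | ⟨x, y, h⟩ := P
  · exact absurd rfl hP
  let K := IntermediateField.adjoin F {x, y}
  let x' : K := ⟨x, IntermediateField.subset_adjoin _ _ (Set.mem_insert x {y})⟩
  let y' : K := ⟨y, IntermediateField.subset_adjoin _ _ (Set.mem_insert_of_mem x rfl)⟩
  have hK : FiniteDimensional F K :=
    IntermediateField.finiteDimensional_adjoin fun z _ ↦ Algebra.IsIntegral.isIntegral z
  refine ⟨K, hK, ?_⟩
  have h' : (W⁄K).toAffine.Nonsingular x' y' :=
    (Affine.baseChange_nonsingular W (f := K.val) K.val.injective _ _).mp h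
  have hmap : Point.map K.val (.some x' y' h') = .some x y h := rfl
  have hord : addOrderOf (.some x' y' h' : (W⁄K).toAffine.Point) = p := by
    refine addOrderOf_eq_prime (Point.map_injective (W' := W) K.val ?_) (Point.some_ne_zero _)
    rw [map_nsmul, hmap, hpP, map_zero]
  exact hord ▸ addOrderOf_dvd_natCard _

open scoped Classical in
lemma exists_not_dvd_frobeniusPowTrace {F k : Type*} [Field F] [Fintype F] [Field k]
    [Algebra F k] [Algebra.IsAlgebraic F k] [IsAlgClosed k] {W : WeierstrassCurve F}
    [W.IsElliptic] {p : ℕ} [Fact p.Prime] (hp : p ∣ Fintype.card F) {P : (W⁄k).toAffine.Point}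
    (hP : P ≠ 0) (hpP : p • P = 0) : ∃ n ≠ 0, ¬ (p : ℤ) ∣ frobeniusPowTrace W k n := by
  obtain ⟨K, _, hK⟩ := exists_intermediateField_dvd_natCard_point hP hpP
  refine ⟨Module.finrank F K, Module.finrank_pos.ne', fun h ↦ ?_⟩
  have hdvd : (p : ℤ) ∣ Fintype.card F ^ Module.finrank F K + 1 := by
    rw [← dvd_sub_left h, ← natCard_point_eq]
    exact Int.natCast_dvd_natCast.mpr hK
  have hp1 := (dvd_add_right (dvd_pow (Int.natCast_dvd_natCast.mpr hp)
    Module.finrank_pos.ne')).mp hdvd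
  exact (Nat.prime_iff_prime_int.mp Fact.out).not_dvd_one hp1

end Torsion

section Recurrence

-- If `τ` and its conjugate are the roots of `T² - b₁ T + r²`, both sides are `τⁿ` plus its
-- conjugate.
lemma exists_eq_two_mul_pow_mul_cos {b : ℕ → ℝ} {r : ℝ} (hr : 0 < r) (h0 : b 0 = 2)
    (hb : ∀ n, b (n + 2) = b 1 * b (n + 1) - r ^ 2 * b n) (h1 : b 1 ^ 2 ≤ 4 * r ^ 2) :
    ∃ θ ∈ Set.Icc 0 Real.pi, ∀ n : ℕ, b n = 2 * r ^ n * Real.cos (n * θ) := by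
  have habs : |b 1 / (2 * r)| ≤ 1 := by
    rw [abs_div, abs_of_pos (by positivity : 0 < 2 * r), div_le_one (by positivity)]
    exact abs_le_of_sq_le_sq (by linarith) (by positivity)
  set θ := Real.arccos (b 1 / (2 * r))
  have hθ : b 1 = 2 * r * Real.cos θ := by
    rw [Real.cos_arccos (abs_le.mp habs).1 (abs_le.mp habs).2]
    field_simp
  refine ⟨θ, ⟨Real.arccos_nonneg _, Real.arccos_le_pi _⟩, fun n ↦ ?_⟩
  induction n using Nat.twoStepInduction with
  | zero => simp [h0]
  | one => simp [hθ]
  | more n ih₀ ih₁ =>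
    have hadd : ((n + 2 : ℕ) : ℝ) * θ = (n + 1 : ℕ) * θ + θ := by push_cast; ring
    have hsub : (n : ℝ) * θ = (n + 1 : ℕ) * θ - θ := by push_cast; ring
    rw [hb, ih₀, ih₁, hθ, hadd, hsub, Real.cos_add, Real.cos_sub]
    ring

lemma modEq_pow_of_recurrence {b : ℕ → ℤ} {q : ℤ}
    (hb : ∀ n, b (n + 2) = b 1 * b (n + 1) - q * b n) {n : ℕ} (hn : n ≠ 0) :
    b n ≡ b 1 ^ n [ZMOD q] := by
  obtain ⟨n, rfl⟩ := Nat.exists_eq_succ_of_ne_zero hn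
  clear hn
  induction n with
  | zero => rw [Nat.succ_eq_add_one, zero_add, pow_one]
  | succ n ih =>
    calc b (n + 2) ≡ b 1 * b (n + 1) [ZMOD q] := Int.modEq_iff_dvd.mpr ⟨b n, by rw [hb]; ring⟩
      _ ≡ b 1 * b 1 ^ (n + 1) [ZMOD q] := ih.mul_left _
      _ = b 1 ^ (n + 2) := (pow_succ' _ _).symm

-- If `m θ` is a multiple of `2 π` then `b (2 m) = 2 qᵐ` is divisible by `p`, but all `b n` with
-- `n ≠ 0` are congruent to powers of `b 1` modulo `p`.
lemma irrational_div_two_pi_of_not_dvd {b : ℕ → ℤ} {p q : ℕ} (hp : p.Prime) (hpq : p ∣ q)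
    (hb : ∀ n, b (n + 2) = b 1 * b (n + 1) - q * b n) {n : ℕ} (hn : n ≠ 0) (hpn : ¬ (p : ℤ) ∣ b n)
    {θ : ℝ} (hcos : ∀ n : ℕ, (b n : ℝ) = 2 * √q ^ n * Real.cos (n * θ)) :
    Irrational (θ / (2 * Real.pi)) := by
  have hpq' : (p : ℤ) ∣ q := Int.natCast_dvd_natCast.mpr hpq
  have hdvd_iff {m : ℕ} (hm : m ≠ 0) : (p : ℤ) ∣ b m ↔ (p : ℤ) ∣ b 1 :=
    ((modEq_pow_of_recurrence hb hm).of_dvd hpq').dvd_iff.trans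
      ((Nat.prime_iff_prime_int.mp hp).dvd_pow_iff_dvd hm)
  rintro ⟨t, ht⟩
  have hangle : ((2 * t.den : ℕ) : ℝ) * θ = ((2 * t.num : ℤ) : ℝ) * (2 * Real.pi) := by
    have hden : (t.den : ℝ) ≠ 0 := Nat.cast_ne_zero.mpr t.den_ne_zero
    rw [eq_div_iff (by positivity), Rat.cast_def] at ht
    rw [← ht]
    push_cast
    field_simp
  have hval : b (2 * t.den) = 2 * (q : ℤ) ^ t.den := by
    have h := hcos (2 * t.den)
    rw [hangle, Real.cos_int_mul_two_pi, mul_one, pow_mul, Real.sq_sqrt q.cast_nonneg] at h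
    exact_mod_cast h
  have hdvd : (p : ℤ) ∣ b (2 * t.den) :=
    hval ▸ (dvd_pow hpq' t.den_ne_zero).mul_left 2
  exact hpn ((hdvd_iff hn).mpr ((hdvd_iff (mul_ne_zero two_ne_zero t.den_ne_zero)).mp hdvd))

end Recurrence

/-! ### Distribution of the cosines of the multiples of an angle -/

section Rotation

open Filter Topology

lemma cos_zsmul_coe (z : ℤ) (θ : ℝ) :
    Real.Angle.cos (z • (θ : Real.Angle)) = Real.cos (z.natAbs * θ) := by
  rw [← Real.Angle.coe_zsmul, Real.Angle.cos_coe, zsmul_eq_mul, Nat.cast_natAbs]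
  obtain h | h := abs_choice z <;> rw [h]
  rw [Int.cast_neg, neg_mul, Real.cos_neg]

lemma Icc_subset_closure_image_cos {θ : ℝ} (h : Irrational (θ / (2 * Real.pi))) :
    Set.Icc (-1 : ℝ) 1 ⊆ closure ((fun n : ℕ ↦ Real.cos (n * θ)) '' {n | 1 ≤ n}) := by
  set S := (fun n : ℕ ↦ Real.cos (n * θ)) '' {n | 1 ≤ n}
  have hdense : DenseRange fun z : ℤ ↦ z • (θ : Real.Angle) :=
    AddCircle.denseRange_zsmul_coe_iff.mpr h
  have hrange : Real.Angle.cos '' Set.range (fun z : ℤ ↦ z • (θ : Real.Angle)) ⊆ {1} ∪ S := by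
    rintro _ ⟨_, ⟨z, rfl⟩, rfl⟩
    obtain h0 | h0 := Nat.eq_zero_or_pos z.natAbs
    · left
      rw [Set.mem_singleton_iff, cos_zsmul_coe, h0, Nat.cast_zero, zero_mul, Real.cos_zero]
    · exact Or.inr ⟨_, h0, (cos_zsmul_coe z θ).symm⟩
  -- The point `1 = cos 0` comes from the excluded index `0`, so it is recovered as a limit.
  have hIco : Set.Ico (-1 : ℝ) 1 ⊆ closure S := by
    intro x hx
    have hmem : x ∈ Real.Angle.cos '' closure (Set.range fun z : ℤ ↦ z • (θ : Real.Angle)) :=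
      ⟨(Real.arccos x : Real.Angle), hdense _, by
        rw [Real.Angle.cos_coe, Real.cos_arccos hx.1 hx.2.le]⟩
    have hcl := closure_mono hrange
      (image_closure_subset_closure_image Real.Angle.continuous_cos hmem)
    rw [closure_union, closure_singleton] at hcl
    exact hcl.resolve_left hx.2.ne
  rw [← closure_Ico (by norm_num : (-1 : ℝ) ≠ 1)]
  exact closure_minimal hIco isClosed_closure

lemma two_mul_sin_mul_sum_cos (θ : ℝ) (N : ℕ) :
    2 * Real.sin θ * ∑ n ∈ Finset.Icc 1 N, Real.cos (2 * (n * θ)) =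
      Real.sin ((2 * N + 1) * θ) - Real.sin θ := by
  induction N with
  | zero => simp
  | succ N ih =>
    have hadd : (2 * ((N + 1 : ℕ) : ℝ) + 1) * θ = 2 * ((N + 1 : ℕ) * θ) + θ := by ring
    have hsub : (2 * (N : ℝ) + 1) * θ = 2 * ((N + 1 : ℕ) * θ) - θ := by push_cast; ring
    rw [Finset.sum_Icc_succ_top N.succ_pos, mul_add, ih, hadd, hsub, Real.sin_add, Real.sin_sub]
    ring

lemma half_sub_le_sum_cos_sq {θ : ℝ} (h : Real.sin θ ≠ 0) (N : ℕ) :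
    (N : ℝ) / 2 - 1 / (2 * |Real.sin θ|) ≤ ∑ n ∈ Finset.Icc 1 N, Real.cos (n * θ) ^ 2 := by
  set T := ∑ n ∈ Finset.Icc 1 N, Real.cos (2 * (n * θ)) with hT
  have hsum : ∑ n ∈ Finset.Icc 1 N, Real.cos (n * θ) ^ 2 = N / 2 + T / 2 := by
    simp only [Real.cos_sq, Finset.sum_add_distrib, Finset.sum_const, Nat.card_Icc,
      add_tsub_cancel_right, nsmul_eq_mul, hT, Finset.sum_div]
    ring
  have hmul : |T| * (2 * |Real.sin θ|) ≤ 2 := by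
    rw [← abs_two, ← abs_mul, ← abs_mul, mul_comm, two_mul_sin_mul_sum_cos, abs_two]
    refine (abs_sub _ _).trans ?_
    linarith [Real.abs_sin_le_one θ, Real.abs_sin_le_one ((2 * N + 1) * θ)]
  have hle : |T| ≤ 2 / (2 * |Real.sin θ|) := (le_div_iff₀ (by positivity)).mpr hmul
  rw [hsum]
  linarith [neg_abs_le T, (by ring : 2 / (2 * |Real.sin θ|) = 2 * (1 / (2 * |Real.sin θ|)))]

lemma sq_le_step {x : ℝ} (hx : |x| ≤ 1) : x ^ 2 ≤
    1 - 7 / 16 * (if x ∈ Set.Icc (-(3 / 4)) (3 / 4) then 1 else 0)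
      - 5 / 16 * (if x ∈ Set.Icc (-(1 / 2)) (1 / 2) then 1 else 0)
      - 3 / 16 * (if x ∈ Set.Icc (-(1 / 4)) (1 / 4) then 1 else 0) := by
  simp only [Set.mem_Icc, ← abs_le]
  rw [← sq_abs]
  have := abs_nonneg x
  split_ifs <;> nlinarith

-- The constant `15 / 32` is the integral over `[0, 1]` of the step function in `sq_le_step`.
lemma IsEquidistributed.eventually_sum_sq_le {u : ℕ → ℝ} (hu : IsEquidistributed u (-1) 1)
    (hu1 : ∀ n, 1 ≤ n → |u n| ≤ 1) {C : ℝ} (hC : 15 / 32 < C) :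
    ∀ᶠ N : ℕ in atTop, ∑ n ∈ Finset.Icc 1 N, u n ^ 2 ≤ C * N := by
  classical
  let A (t : ℝ) (N : ℕ) : ℝ := ((Finset.Icc 1 N).filter (fun n ↦ u n ∈ Set.Icc (-t) t)).card
  have hA {t : ℝ} (h₀ : 0 ≤ t) (h₁ : t ≤ 1) : Tendsto (fun N ↦ A t N / N) atTop (𝓝 t) := by
    have := hu (-t) t (by linarith) (by linarith) h₁
    rw [(by ring : (t - -t) / (1 - -1) = t)] at this
    convert this
  have hsum (N : ℕ) : ∑ n ∈ Finset.Icc 1 N, u n ^ 2 ≤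
      N - 7 / 16 * A (3 / 4) N - 5 / 16 * A (1 / 2) N - 3 / 16 * A (1 / 4) N := by
    refine (Finset.sum_le_sum fun n hn ↦
      sq_le_step (hu1 n (Finset.mem_Icc.mp hn).1)).trans_eq ?_
    simp only [Finset.sum_sub_distrib, ← Finset.mul_sum, Finset.sum_boole, Finset.sum_const,
      Nat.card_Icc, add_tsub_cancel_right, nsmul_eq_mul, mul_one, A]
  have hlim : Tendsto (fun N : ℕ ↦ 1 - 7 / 16 * (A (3 / 4) N / N) - 5 / 16 * (A (1 / 2) N / N)
      - 3 / 16 * (A (1 / 4) N / N)) atTop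
      (𝓝 (1 - 7 / 16 * (3 / 4) - 5 / 16 * (1 / 2) - 3 / 16 * (1 / 4))) :=
    ((tendsto_const_nhds.sub ((hA (by norm_num) (by norm_num)).const_mul _)).sub
      ((hA (by norm_num) (by norm_num)).const_mul _)).sub
      ((hA (by norm_num) (by norm_num)).const_mul _)
  filter_upwards [hlim.eventually_lt_const (u := C) (by linarith), eventually_gt_atTop 0]
    with N hN hN0
  calc ∑ n ∈ Finset.Icc 1 N, u n ^ 2
    _ ≤ N - 7 / 16 * A (3 / 4) N - 5 / 16 * A (1 / 2) N - 3 / 16 * A (1 / 4) N := hsum N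
    _ = (1 - 7 / 16 * (A (3 / 4) N / N) - 5 / 16 * (A (1 / 2) N / N)
        - 3 / 16 * (A (1 / 4) N / N)) * N := by field_simp
    _ ≤ C * N := by gcongr

lemma not_isEquidistributed_of_eq_cos {θ : ℝ} (h : Real.sin θ ≠ 0) {u : ℕ → ℝ}
    (hu : ∀ n, 1 ≤ n → u n = Real.cos (n * θ)) : ¬ IsEquidistributed u (-1) 1 := by
  intro he
  have hupper := he.eventually_sum_sq_le (C := 31 / 64)
    (fun n hn ↦ hu n hn ▸ Real.abs_cos_le_one _) (by norm_num)
  have hlarge : ∀ᶠ N : ℕ in atTop, 64 * (1 / (2 * |Real.sin θ|)) < (N : ℝ) :=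
    tendsto_natCast_atTop_atTop.eventually_gt_atTop _
  obtain ⟨N, hN, hN'⟩ := (hupper.and hlarge).exists
  rw [Finset.sum_congr rfl fun n hn ↦ by rw [hu n (Finset.mem_Icc.mp hn).1]] at hN
  linarith [half_sub_le_sum_cos_sq h N]

lemma sin_ne_zero_of_irrational {θ : ℝ} (h : Irrational (θ / (2 * Real.pi))) :
    Real.sin θ ≠ 0 := by
  intro h0
  obtain ⟨m, rfl⟩ := Real.sin_eq_zero_iff.mp h0
  refine h ⟨m / 2, ?_⟩
  push_cast
  field_simp

lemma isDenseInInterval_of_eq_cos {θ : ℝ} (h : Irrational (θ / (2 * Real.pi))) {u : ℕ → ℝ}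
    (hu : ∀ n, 1 ≤ n → u n = Real.cos (n * θ)) : IsDenseInInterval u (-1) 1 := by
  refine ⟨fun n hn ↦ hu n hn ▸ Real.cos_mem_Icc _, ?_⟩
  rw [Set.image_congr (s := {n | 1 ≤ n}) hu]
  exact Icc_subset_closure_image_cos h

end Rotation

section Eigenvalues

lemma polar_pow_add_conj_pow (r θ : ℝ) (n : ℕ) :
    (r * Complex.exp (θ * Complex.I)) ^ n + starRingEnd ℂ (r * Complex.exp (θ * Complex.I)) ^ n =
      (2 * r ^ n * Real.cos (n * θ) : ℝ) := by
  rw [map_mul, ← Complex.exp_conj, map_mul, Complex.conj_ofReal, Complex.conj_ofReal,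
    Complex.conj_I, mul_pow, mul_pow, ← Complex.exp_nat_mul, ← Complex.exp_nat_mul]
  push_cast
  rw [Complex.cos]
  ring_nf

lemma polar_mul_conj (r θ : ℝ) :
    (r * Complex.exp (θ * Complex.I)) * starRingEnd ℂ (r * Complex.exp (θ * Complex.I)) =
      (r ^ 2 : ℝ) := by
  rw [Complex.mul_conj, Complex.normSq_eq_norm_sq, norm_mul, Complex.norm_exp_ofReal_mul_I,
    mul_one, Complex.norm_real, Real.norm_eq_abs, sq_abs]

open Polynomial in
lemma roots_X_sq_sub_C_mul_X_add_C {R : Type*} [CommRing R] [IsDomain R] {a b τ σ : R}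
    (hadd : τ + σ = a) (hmul : τ * σ = b) : (X ^ 2 - C a * X + C b).roots = {τ, σ} := by
  have hfactor : X ^ 2 - C a * X + C b = (X - C τ) * (X - C σ) := by
    rw [← hadd, ← hmul, C_add, C_mul]
    ring
  rw [hfactor, roots_mul (mul_ne_zero (X_sub_C_ne_zero _) (X_sub_C_ne_zero _)), roots_X_sub_C,
    roots_X_sub_C]
  rfl

variable {F : Type*} [Field F] [Fintype F] (W : WeierstrassCurve F) [W.IsElliptic]
  (k : Type*) [Field k] [IsAlgClosed k] [Algebra F k]

lemma exists_frobeniusPowTrace_eq : ∃ θ ∈ Set.Icc 0 Real.pi, ∀ n : ℕ,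
    (frobeniusPowTrace W k n : ℝ) = 2 * √(Fintype.card F) ^ n * Real.cos (n * θ) := by
  have hsq : √(Fintype.card F) ^ 2 = (Fintype.card F : ℝ) := Real.sq_sqrt (Nat.cast_nonneg _)
  refine exists_eq_two_mul_pow_mul_cos (Real.sqrt_pos.mpr (Nat.cast_pos.mpr Fintype.card_pos))
    (by exact_mod_cast frobeniusPowTrace_zero W k) (fun n ↦ ?_) ?_
  · rw [hsq]
    exact_mod_cast frobeniusPowTrace_add_two W k n
  · rw [hsq]
    exact_mod_cast sq_frobeniusPowTrace_one_le W k

end Eigenvalues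

lemma isElliptic_reductionMod {E : WeierstrassCurve ℚ} {p : ℕ} [Fact p.Prime]
    (h : (minimalModel E p).HasGoodReduction ℤ_[p]) : (reductionMod E p).IsElliptic := by
  have := (hasGoodReduction_iff_isElliptic_reduction ℤ_[p]).mp h
  unfold reductionMod
  infer_instance

end FrobeniusTraces

open FrobeniusTraces WeierstrassCurve in
open scoped Classical in
theorem lemma2p1_general {F : Type*} [Field F] [Fintype F] {q : ℕ} (hq : Fintype.card F = q)
    {p : ℕ} [CharP F p] (W : WeierstrassCurve F) [W.IsElliptic]
    (hW : ∃ P : (W⁄(AlgebraicClosure F)).toAffine.Point, P ≠ 0 ∧ p • P = 0)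
    {L : ℕ → Type*} [∀ n, Field (L n)] [∀ n, Algebra F (L n)]
    (hL : ∀ n, 1 ≤ n → Module.finrank F (L n) = n) {a : ℕ → ℤ}
    (ha : ∀ n, 1 ≤ n → a n = (q : ℤ) ^ n + 1 - Nat.card (W⁄(L n)).toAffine.Point) {α : ℕ → ℝ}
    (hα : ∀ n, 1 ≤ n → α n = a n / (2 * (q : ℝ) ^ ((n : ℝ) / 2))) :
    (∃ θ ∈ Set.Icc (0 : ℝ) Real.pi, ∃ τ : ℂ,
      τ = ((q : ℝ) ^ ((1 : ℝ) / 2) : ℝ) * Complex.exp (θ * Complex.I) ∧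
      (Polynomial.X ^ 2 - Polynomial.C (a 1 : ℂ) * Polynomial.X + Polynomial.C (q : ℂ)).roots =
        {τ, starRingEnd ℂ τ} ∧
      (∀ n : ℕ, 1 ≤ n → (a n : ℂ) = τ ^ n + (starRingEnd ℂ τ) ^ n ∧ α n = Real.cos (n * θ))) ∧
    IsDenseInInterval α (-1) 1 ∧ ¬ IsEquidistributed α (-1) 1 := by
  subst hq
  have hp : p.Prime := CharP.char_is_prime F p
  have : Fact p.Prime := ⟨hp⟩
  obtain ⟨P, hP, hpP⟩ := hW
  obtain ⟨θ, hθ, hb⟩ := exists_frobeniusPowTrace_eq W (AlgebraicClosure F)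
  have hpq : p ∣ Fintype.card F :=
    (CharP.cast_eq_zero_iff F p _).mp (FiniteField.cast_card_eq_zero F)
  obtain ⟨m, hm, hpm⟩ := exists_not_dvd_frobeniusPowTrace hpq hP hpP
  have hirr : Irrational (θ / (2 * Real.pi)) :=
    irrational_div_two_pi_of_not_dvd hp hpq (frobeniusPowTrace_add_two W _) hm hpm hb
  have ha' (n : ℕ) (hn : 1 ≤ n) : (a n : ℝ) = 2 * √(Fintype.card F) ^ n * Real.cos (n * θ) := by
    have : FiniteDimensional F (L n) := FiniteDimensional.of_finrank_pos ((hL n hn).symm ▸ hn)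
    rw [ha n hn, natCard_point_eq W (AlgebraicClosure F), hL n hn, sub_sub_cancel, hb]
  have hcos (n : ℕ) (hn : 1 ≤ n) : α n = Real.cos (n * θ) := by
    have : 0 < √(Fintype.card F) := Real.sqrt_pos.mpr (Nat.cast_pos.mpr Fintype.card_pos)
    rw [hα n hn, ha' n hn, Real.rpow_div_two_eq_sqrt _ (Nat.cast_nonneg _), Real.rpow_natCast]
    field_simp
  rw [← Real.sqrt_eq_rpow]
  have htrace (n : ℕ) (hn : 1 ≤ n) :=
    (polar_pow_add_conj_pow _ θ n).trans (congr_arg ((↑) : ℝ → ℂ) (ha' n hn)).symm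
  refine ⟨⟨θ, hθ, _, rfl, roots_X_sq_sub_C_mul_X_add_C ?_ ?_, fun n hn ↦ ⟨?_, hcos n hn⟩⟩,
    isDenseInInterval_of_eq_cos hirr hcos,
    not_isEquidistributed_of_eq_cos (sin_ne_zero_of_irrational hirr) hcos⟩
  · simpa only [pow_one, Complex.ofReal_intCast] using htrace 1 le_rfl
  · rw [polar_mul_conj, Real.sq_sqrt (Nat.cast_nonneg _), Complex.ofReal_natCast]
  · rw [htrace n hn, Complex.ofReal_intCast]

theorem lemma2p1 (E : WeierstrassCurve ℚ) [E.IsElliptic] (p : ℕ) [Fact p.Prime]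
    (hE : FrobeniusTraces.HasGoodOrdinaryReduction E p) :
    (∃ θ ∈ Set.Icc (0 : ℝ) Real.pi, ∃ τ : ℂ,
      τ = ((p : ℝ) ^ ((1 : ℝ) / 2) : ℝ) * Complex.exp (θ * Complex.I) ∧
      (FrobeniusTraces.frobeniusPolynomial E p).roots = {τ, starRingEnd ℂ τ} ∧
      (∀ n : ℕ, 1 ≤ n →
        (FrobeniusTraces.frobeniusTrace E p n : ℂ) = τ ^ n + (starRingEnd ℂ τ) ^ n ∧
        FrobeniusTraces.normalizedTrace E p n = Real.cos (n * θ))) ∧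
    FrobeniusTraces.IsDenseInInterval (FrobeniusTraces.normalizedTrace E p) (-1) 1 ∧
    ¬ FrobeniusTraces.IsEquidistributed (FrobeniusTraces.normalizedTrace E p) (-1) 1 := by
  have := FrobeniusTraces.isElliptic_reductionMod hE.1
  exact lemma2p1_general (ZMod.card p) (FrobeniusTraces.reductionMod E p) hE.2
    (L := GaloisField p) (fun n hn ↦ GaloisField.finrank p (Nat.one_le_iff_ne_zero.mp hn))
    (fun _ _ ↦ rfl) fun _ _ ↦ rfl
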